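/- Let $d,n\ge 1$. Let $\mathbb B_d$ be the open unit ball of $\mathbb C^d$, $\langle z,w\rangle=\sum_j z_j\overline{w_j}$, and for $\lambda\in\mathbb B_d$ let $$\varphi_\lambda(z)=\frac{\lambda-P_\lambda z-\sqrt{1-\|\lambda\|^2}\,(I-P_\lambda)z}{1-\langle z,\lambda\rangle},$$ where $P_\lambda$ is the orthogonal projection onto $\mathbb C\lambda$ (so $\varphi_0(z)=-z$). Let $d_{ph}(z,w)=\|\varphi_z(w)\|$. Let $\mathbb X_{d,n}=\mathbb B_d^n/S_n$ be the space of unordered $n$-tuples of points of $\mathbb B_d$, with the topology of the metric $d_s([X],[Y])=\min_{\sigma\in S_n}\max_j d_{ph}(x_j,y_{\sigma(j)})$, and let $\mathbb X^0_{d,n}\subset\mathbb X_{d,n}$ be the subspace of the $n$-tuples of distinct points. Let $H^2_d$ be the Drury–Arveson space, the completion of $\mathbb C[z_1,\dots,z_d]$ for the inner product $\langle z^\alpha,z^\beta\rangle=\delta_{\alpha\beta}\,\alpha!/|\alpha|!$, viewed as a Hilbert space of functions on $\mathbb B_d$ with kernel functions $k_\lambda(z)=(1-\langle z,\lambda\rangle)^{-1}$;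 let $\mathcal M_d$ be its multiplier algebra, $M_f$ the operator of multiplication by $f\in\mathcal M_d$, and $M_z=(M_{z_1},\dots,M_{z_d})$. Let $$\mathbb P_{d,n}=\{P\in B(H^2_d): P=P^2=P^*,\ PM_f^*P=M_f^*P\ \text{for all } f\in\mathcal M_d,\ \dim PH^2_d=n\}$$ with the norm topology. For $P\in\mathbb P_{d,n}$ let $A=PM_z|_{PH^2_d}$ and $$\Psi_{d,n}(P)=\sum_{\lambda\in\sigma(A)}\dim R_\lambda(A)\,[\lambda],$$ where $\sigma(A)=\{\lambda\in\mathbb C^d:\bigcap_j\ker(A_j-\lambda_j I)\ne 0\}$ and $R_\lambda(A)=\bigcap_{|\alpha|=n}\ker(A-\lambda I)^\alpha$. This is a well-defined map $\Psi_{d,n}:\mathbb P_{d,n}\to\mathbb X_{d,n}$; put $\mathbb P^0_{d,n}=\Psi_{d,n}^{-1}(\mathbb X^0_{d,n})$. For distinct points $\lambda_1,\dots,\lambda_n\in\mathbb B_d$, in some order, let $b_1=\varphi_{\lambda_1}$, viewed as a row, and for $2\le m\le n$ let $$b_m(z)=b_{m-1}(z)\,U_m\begin{pmatrix}\varphi_{\lambda_m}(z)&0\\0&I_{(m-1)(d-1)}\end{pmatrix},$$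 where $U_m$ is any unitary matrix of size $(m-1)(d-1)+1$ with first column $b_{m-1}(\lambda_m)^*/\|b_{m-1}(\lambda_m)\|$. Write $b_X=b_n$, a row of size $(n-1)(d-1)+d$. Then for every $[X]=\sum_j[\lambda_j]\in\mathbb X^0_{d,n}$ and every ordering of its points such a $b_X$ exists; for every choice of the ordering and of the unitaries, multiplication by $b_X$ defines a bounded partial isometry $M_{b_X}:H^2_d\otimes\mathbb C^{(n-1)(d-1)+d}\to H^2_d$ with range $H^2_d\ominus\mathrm{Span}\{k_{\lambda_1},\dots,k_{\lambda_n}\}$, and $I-M_{b_X}M_{b_X}^*$ belongs to $\mathbb P^0_{d,n}$ and does not depend on the choices. The map $\Phi_{d,n}:\mathbb X^0_{d,n}\to\mathbb P^0_{d,n}$, $[X]\mapsto I-M_{b_X}M_{b_X}^*$, is continuous, $\Psi_{d,n}\circ\Phi_{d,n}=\mathrm{Id}_{\mathbb X^0_{d,n}}$ and $\Phi_{d,n}\circ\Psi_{d,n}|_{\mathbb P^0_{d,n}}=\mathrm{Id}_{\mathbb P^0_{d,n}}$. Hence $\Psi_{d,n}$ restricts to a homeomorphism from $\mathbb P^0_{d,n}$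 onto $\mathbb X^0_{d,n}$ with inverse $\Phi_{d,n}$. -/

import Mathlib

open scoped InnerProductSpace

noncomputable section

/-! ### The unit ball, its involutions and the symmetrized polyball -/

/-- The open Euclidean unit ball of `ℂ^d`. -/
abbrev UnitBall (d : ℕ) : Type :=
  Metric.ball (0 : EuclideanSpace ℂ (Fin d)) 1

/-- The orthogonal projection `P_λ z = ‖λ‖⁻² ⟨z, λ⟩ λ` onto the line spanned by `lam` (zero if
`lam = 0`). Mathlib's inner product is conjugate-linear in its first slot, so `⟨z, λ⟩` is
`⟪lam, z⟫_ℂ`. -/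
def lineProj {d : ℕ} (lam z : EuclideanSpace ℂ (Fin d)) : EuclideanSpace ℂ (Fin d) :=
  (⟪lam, z⟫_ℂ / (‖lam‖ : ℂ) ^ 2) • lam

/-- The involution `φ_λ` of the ball that exchanges `0` and `lam`; `φ_0 z = -z`. -/
def ballInvolution {d : ℕ} (lam z : EuclideanSpace ℂ (Fin d)) : EuclideanSpace ℂ (Fin d) :=
  (1 - ⟪lam, z⟫_ℂ)⁻¹ •
    (lam - lineProj lam z - (Real.sqrt (1 - ‖lam‖ ^ 2) : ℂ) • (z - lineProj lam z))

/-- The pseudohyperbolic distance on the ball. -/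
def pseudohyperbolicDist {d : ℕ} (z w : UnitBall d) : ℝ :=
  ‖ballInvolution (z : EuclideanSpace ℂ (Fin d)) w‖

/-- The symmetrized polyball: unordered `n`-tuples of points of the ball, with multiplicity. -/
def SymPolyball (d n : ℕ) : Type :=
  Sym (UnitBall d) n

/-- The symmetrization map from ordered to unordered `n`-tuples. -/
def symmetrize {d n : ℕ} (x : Fin n → UnitBall d) : SymPolyball d n :=
  Sym.mk (Finset.univ.val.map x) (by simp)

/-- The symmetric distance: the least value of `max_j d_ph(x_j, y_j)` over all orderings `x`, `y`
of the two unordered tuples. -/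
def symDist {d n : ℕ} (X Y : SymPolyball d n) : ℝ :=
  sInf {r : ℝ | ∃ x y : Fin n → UnitBall d, symmetrize x = X ∧ symmetrize y = Y ∧
    r = ⨆ j, pseudohyperbolicDist (x j) (y j)}

/-- The topology of the distance `symDist`. -/
instance (d n : ℕ) : TopologicalSpace (SymPolyball d n) where
  IsOpen U := ∀ X ∈ U, ∃ ε > 0, ∀ Y, symDist X Y < ε → Y ∈ U
  isOpen_univ := fun _ _ => ⟨1, one_pos, fun _ _ => trivial⟩
  isOpen_inter := by
    intro U V hU hV X hX
    obtain ⟨ε, hε, h⟩ := hU X hX.1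
    obtain ⟨δ, hδ, h'⟩ := hV X hX.2
    exact ⟨min ε δ, lt_min hε hδ, fun Y hY =>
      ⟨h Y (hY.trans_le (min_le_left _ _)), h' Y (hY.trans_le (min_le_right _ _))⟩⟩
  isOpen_sUnion := by
    intro S hS X hX
    obtain ⟨U, hU, hXU⟩ := hX
    obtain ⟨ε, hε, h⟩ := hS U hU X hXU
    exact ⟨ε, hε, fun Y hY => ⟨U, hU, h Y hY⟩⟩

/-- The configuration space of `n` distinct unordered points of the ball. -/
def configSpace (d n : ℕ) : Set (SymPolyball d n) :=
  symmetrize '' {x : Fin n → UnitBall d | Function.Injective x}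

/-! ### The Drury-Arveson space -/

/-- The Drury-Arveson space in `d` variables, the completion of the polynomials for the inner
product with `⟨z^α, z^β⟩ = δ_{αβ} α! / |α|!`. The sequence `c` represents the function
`∑_α c_α (|α|! / α!)^{1/2} z^α`, so that the unit vectors of `ℓ²` represent the normalized
monomials. -/
def DruryArveson (d : ℕ) : Type :=
  lp (fun _ : Fin d → ℕ => ℂ) 2

namespace DruryArveson

instance (d : ℕ) : NormedAddCommGroup (DruryArveson d) :=
  inferInstanceAs (NormedAddCommGroup (lp (fun _ : Fin d → ℕ => ℂ) 2))

instance (d : ℕ) : InnerProductSpace ℂ (DruryArveson d) :=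
  inferInstanceAs (InnerProductSpace ℂ (lp (fun _ : Fin d → ℕ => ℂ) 2))

instance (d : ℕ) : CompleteSpace (DruryArveson d) :=
  inferInstanceAs (CompleteSpace (lp (fun _ : Fin d → ℕ => ℂ) 2))

/-- The coefficients of an element with respect to the normalized monomials. -/
def coeff {d : ℕ} (f : DruryArveson d) (α : Fin d → ℕ) : ℂ :=
  (show lp (fun _ : Fin d → ℕ => ℂ) 2 from f) α

/-- The value at `z` of the normalized monomial `(|α|! / α!)^{1/2} z^α`. -/
def normMonomial {d : ℕ} (α : Fin d → ℕ) (z : EuclideanSpace ℂ (Fin d)) : ℂ :=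
  (Real.sqrt (((∑ j, α j).factorial : ℝ) / ∏ j, ((α j).factorial : ℝ)) : ℂ) * ∏ j, z j ^ α j

/-- The value `∑_α c_α (|α|! / α!)^{1/2} z^α` of an element at a point of the ball. -/
def evalAt {d : ℕ} (f : DruryArveson d) (z : UnitBall d) : ℂ :=
  ∑' α, coeff f α * normMonomial α z

theorem norm_normMonomial_sq {d : ℕ} (α : Fin d → ℕ) (z : EuclideanSpace ℂ (Fin d)) :
    ‖normMonomial α z‖ ^ 2 = Nat.multinomial Finset.univ α * ∏ j, (‖z j‖ ^ 2) ^ α j := by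
  have hm : ((∑ j, α j).factorial : ℝ) / ∏ j, ((α j).factorial : ℝ)
      = Nat.multinomial Finset.univ α := by
    rw [div_eq_iff (by positivity), mul_comm]
    exact_mod_cast (Nat.multinomial_spec Finset.univ α).symm
  rw [normMonomial, hm, norm_mul, mul_pow, norm_prod, Complex.norm_real, Real.norm_eq_abs, sq_abs,
    Real.sq_sqrt (Nat.cast_nonneg _), ← Finset.prod_pow]
  congr 1
  refine Finset.prod_congr rfl fun j _ => ?_
  rw [norm_pow, ← pow_mul, ← pow_mul, mul_comm]

/-- The kernel sequence `α ↦ conj (e_α(z))`, where `e_α` are the normalized monomials. -/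
theorem memℓp_conj_normMonomial {d : ℕ} (z : UnitBall d) :
    Memℓp (fun α : Fin d → ℕ => (starRingEnd ℂ) (normMonomial α z)) 2 := by
  set s : ℝ := ∑ j, ‖(z : EuclideanSpace ℂ (Fin d)) j‖ ^ 2 with hs
  have hs0 : 0 ≤ s := Finset.sum_nonneg fun j _ => by positivity
  have hs1 : s < 1 := by
    have h1 : ‖(z : EuclideanSpace ℂ (Fin d))‖ < 1 := mem_ball_zero_iff.1 z.2
    rw [hs, ← EuclideanSpace.norm_sq_eq]
    nlinarith [norm_nonneg (z : EuclideanSpace ℂ (Fin d))]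
  refine memℓp_gen' (C := (1 - s)⁻¹) fun S => ?_
  have hterm : ∀ α : Fin d → ℕ, ‖(starRingEnd ℂ) (normMonomial α z)‖ ^ (2 : ENNReal).toReal
      = Nat.multinomial Finset.univ α *
        ∏ j, (‖(z : EuclideanSpace ℂ (Fin d)) j‖ ^ 2) ^ α j := by
    intro α
    rw [RCLike.norm_conj, ← norm_normMonomial_sq]
    norm_num
  simp_rw [hterm]
  set N := S.sup (fun α => ∑ j, α j) + 1 with hN
  calc _ ≤ ∑ α ∈ (Finset.range N).biUnion (fun m => Finset.piAntidiag Finset.univ m),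
        (Nat.multinomial Finset.univ α : ℝ) *
          ∏ j, (‖(z : EuclideanSpace ℂ (Fin d)) j‖ ^ 2) ^ α j := by
        refine Finset.sum_le_sum_of_subset_of_nonneg ?_ fun _ _ _ => by positivity
        intro α hα
        simp only [Finset.mem_biUnion, Finset.mem_range, Finset.mem_piAntidiag]
        refine ⟨∑ j, α j, ?_, rfl, by simp⟩
        have := Finset.le_sup (f := fun α : Fin d → ℕ => ∑ j, α j) hα
        omega
    _ = ∑ m ∈ Finset.range N, s ^ m := by
        rw [Finset.sum_biUnion]
        · refine Finset.sum_congr rfl fun m _ => ?_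
          rw [hs, Finset.sum_pow_eq_sum_piAntidiag]
        · intro a _ b _ hab
          refine Finset.disjoint_left.2 fun α h1 h2 => hab ?_
          rw [← (Finset.mem_piAntidiag.1 h1).1, ← (Finset.mem_piAntidiag.1 h2).1]
    _ ≤ ∑' m, s ^ m :=
        (summable_geometric_of_lt_one hs0 hs1).sum_le_tsum _ fun _ _ => by positivity
    _ = (1 - s)⁻¹ := tsum_geometric_of_lt_one hs0 hs1

/-- The kernel function `k_z`, as a sequence of coefficients. -/
def kernelVec {d : ℕ} (z : UnitBall d) : DruryArveson d :=
  (⟨_, memℓp_conj_normMonomial z⟩ : lp (fun _ : Fin d → ℕ => ℂ) 2)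

theorem hasSum_evalAt {d : ℕ} (f : DruryArveson d) (z : UnitBall d) :
    HasSum (fun α => coeff f α * normMonomial α z) ⟪kernelVec z, f⟫_ℂ := by
  have h := lp.hasSum_inner (𝕜 := ℂ) (G := fun _ : Fin d → ℕ => ℂ) (kernelVec z) f
  have e : (fun α => coeff f α * normMonomial α z) = fun α : Fin d → ℕ =>
      ⟪(show lp (fun _ : Fin d → ℕ => ℂ) 2 from kernelVec z) α,
        (show lp (fun _ : Fin d → ℕ => ℂ) 2 from f) α⟫_ℂ := by
    funext α
    simp [kernelVec, coeff, RCLike.inner_apply]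
  rw [e]
  exact h

theorem evalAt_eq_inner {d : ℕ} (f : DruryArveson d) (z : UnitBall d) :
    evalAt f z = ⟪kernelVec z, f⟫_ℂ :=
  (hasSum_evalAt f z).tsum_eq

/-- An element whose values all vanish is zero. -/
theorem eq_zero_of_evalAt {d : ℕ} (f : DruryArveson d) (hf : ∀ z, evalAt f z = 0) : f = 0 := by
  classical
  have hhom : ∀ (m : ℕ) (z : UnitBall d),
      ∑ α ∈ Finset.piAntidiag Finset.univ m, coeff f α * normMonomial α z = 0 := by
    intro m z
    set a : ℕ → ℂ := fun m =>
      ∑ α ∈ Finset.piAntidiag Finset.univ m, coeff f α * normMonomial α z with ha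
    have key : ∀ t : ℂ, ‖t‖ < 1 → HasSum (fun m => t ^ m • a m) 0 := by
      intro t ht
      have hz : ‖(z : EuclideanSpace ℂ (Fin d))‖ < 1 := mem_ball_zero_iff.1 z.2
      have htz : t • (z : EuclideanSpace ℂ (Fin d)) ∈
          Metric.ball (0 : EuclideanSpace ℂ (Fin d)) 1 := by
        rw [mem_ball_zero_iff, norm_smul]
        nlinarith [norm_nonneg t, norm_nonneg (z : EuclideanSpace ℂ (Fin d))]
      have h := hasSum_evalAt f ⟨_, htz⟩
      rw [← evalAt_eq_inner, hf] at h
      rw [← (Equiv.sigmaFiberEquiv (fun α : Fin d → ℕ => ∑ j, α j)).hasSum_iff] at h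
      refine h.sigma fun m => ?_
      have e2 : ∀ α : {α : Fin d → ℕ // ∑ j, α j = m},
          coeff f α * normMonomial (α : Fin d → ℕ) (t • (z : EuclideanSpace ℂ (Fin d)))
            = t ^ m * (coeff f α * normMonomial (α : Fin d → ℕ) z) := by
        rintro ⟨α, rfl⟩
        simp only [normMonomial, PiLp.smul_apply, smul_eq_mul, mul_pow, Finset.prod_mul_distrib,
          Finset.prod_pow_eq_pow_sum]
        ring
      have e3 : t ^ m • a m = ∑ α ∈ Finset.piAntidiag Finset.univ m,
          t ^ m * (coeff f α * normMonomial (α : Fin d → ℕ) z) := by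
        rw [ha, smul_eq_mul, Finset.mul_sum]
      rw [e3]
      have hF : HasSum (fun α : {α : Fin d → ℕ // α ∈ Finset.piAntidiag Finset.univ m} =>
          t ^ m * (coeff f α * normMonomial (α : Fin d → ℕ) z))
          (∑ α ∈ Finset.piAntidiag Finset.univ m,
            t ^ m * (coeff f α * normMonomial (α : Fin d → ℕ) z)) :=
        Finset.hasSum _ (fun α : Fin d → ℕ =>
          t ^ m * (coeff f α * normMonomial (α : Fin d → ℕ) z))
      let E : {α : Fin d → ℕ // ∑ j, α j = m} ≃
          {α : Fin d → ℕ // α ∈ Finset.piAntidiag Finset.univ m} :=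
        Equiv.subtypeEquivRight fun α => by simp [Finset.mem_piAntidiag]
      rw [← E.hasSum_iff] at hF
      convert! hF using 1
      funext α
      exact e2 α
    have hp : HasFPowerSeriesAt (fun _ : ℂ => (0 : ℂ))
        (FormalMultilinearSeries.ofScalars ℂ a) 0 := by
      rw [hasFPowerSeriesAt_iff]
      filter_upwards [Metric.ball_mem_nhds (0 : ℂ) one_pos] with t ht
      simpa [FormalMultilinearSeries.coeff_ofScalars] using key t (by simpa using ht)
    have h0 := hp.eq_zero
    have h1 : (FormalMultilinearSeries.ofScalars ℂ a).coeff m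
        = (0 : FormalMultilinearSeries ℂ ℂ ℂ).coeff m := by rw [h0]
    rw [FormalMultilinearSeries.coeff_ofScalars] at h1
    simpa [FormalMultilinearSeries.coeff] using h1
  have hw : ∀ α : Fin d → ℕ,
      (Real.sqrt (((∑ j, α j).factorial : ℝ) / ∏ j, ((α j).factorial : ℝ)) : ℂ) ≠ 0 := by
    intro α
    exact_mod_cast (Real.sqrt_pos.2 (by positivity)).ne'
  have hcoeff : ∀ α, coeff f α = 0 := by
    intro β
    set m := ∑ j, β j with hm
    set q : MvPolynomial (Fin d) ℂ := ∑ α ∈ Finset.piAntidiag Finset.univ m,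
      MvPolynomial.monomial (Finsupp.equivFunOnFinite.symm α) (coeff f α *
        (Real.sqrt (((∑ j, α j).factorial : ℝ) / ∏ j, ((α j).factorial : ℝ)) : ℂ)) with hq
    have hqe : ∀ z : Fin d → ℂ, MvPolynomial.eval z q
        = ∑ α ∈ Finset.piAntidiag Finset.univ m, coeff f α * normMonomial α (WithLp.toLp 2 z) := by
      intro z
      rw [hq, map_sum]
      refine Finset.sum_congr rfl fun α _ => ?_
      rw [MvPolynomial.eval_monomial, normMonomial, Finsupp.prod_fintype _ _ (by simp)]
      simp [mul_assoc]
    have hq0 : q = 0 := by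
      refine MvPolynomial.funext fun z => ?_
      rw [hqe, map_zero]
      set v : EuclideanSpace ℂ (Fin d) := WithLp.toLp 2 z with hv
      set r : ℂ := (((1 + ‖v‖)⁻¹ : ℝ) : ℂ) with hr
      have hr0 : r ≠ 0 := by
        rw [hr]
        exact_mod_cast (inv_pos.2 (by positivity : (0 : ℝ) < 1 + ‖v‖)).ne'
      have hrv : r • v ∈ Metric.ball (0 : EuclideanSpace ℂ (Fin d)) 1 := by
        rw [mem_ball_zero_iff, norm_smul, hr, Complex.norm_real, Real.norm_eq_abs,
          abs_of_nonneg (by positivity), inv_mul_lt_iff₀ (by positivity)]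
        linarith
      have h := hhom m ⟨_, hrv⟩
      have h' : ∑ α ∈ Finset.piAntidiag Finset.univ m, coeff f α * normMonomial α (r • v)
          = r ^ m * ∑ α ∈ Finset.piAntidiag Finset.univ m, coeff f α * normMonomial α v := by
        rw [Finset.mul_sum]
        refine Finset.sum_congr rfl fun α hα => ?_
        rw [← (Finset.mem_piAntidiag.1 hα).1]
        simp only [normMonomial, PiLp.smul_apply, smul_eq_mul, mul_pow, Finset.prod_mul_distrib,
          Finset.prod_pow_eq_pow_sum]
        ring
      rw [h'] at h
      exact (mul_eq_zero.1 h).resolve_left (pow_ne_zero _ hr0)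
    have hc := congrArg (MvPolynomial.coeff (Finsupp.equivFunOnFinite.symm β)) hq0
    rw [hq, MvPolynomial.coeff_sum, Finset.sum_eq_single β] at hc
    · rw [MvPolynomial.coeff_monomial, if_pos rfl, MvPolynomial.coeff_zero] at hc
      exact (mul_eq_zero.1 hc).resolve_right (hw β)
    · intro α _ hα
      rw [MvPolynomial.coeff_monomial, if_neg]
      exact fun h => hα (Finsupp.equivFunOnFinite.symm.injective h)
    · intro h
      exact absurd (Finset.mem_piAntidiag.2 ⟨hm.symm, by simp⟩) h
  exact lp.ext (funext hcoeff)

/-- The Drury-Arveson space as a reproducing kernel Hilbert space of functions on the ball. The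
kernel functions are Mathlib's `RKHS.kerFun`. -/
instance (d : ℕ) : RKHS ℂ (DruryArveson d) (UnitBall d) ℂ where
  coeCLM := ContinuousLinearMap.pi fun z => innerSL ℂ (kernelVec z)
  coeCLM_injective := by
    refine (injective_iff_map_eq_zero _).2 fun f hf => eq_zero_of_evalAt f fun z => ?_
    rw [evalAt_eq_inner]
    exact congrFun hf z

theorem apply_eq_evalAt {d : ℕ} (f : DruryArveson d) (z : UnitBall d) : f z = evalAt f z :=
  (evalAt_eq_inner f z).symm

end DruryArveson

/-! ### Multipliers -/

/-- `T` is the (bounded) operator of multiplication by the function `f`. -/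
def IsMultiplicationOp {d : ℕ} (f : UnitBall d → ℂ)
    (T : DruryArveson d →L[ℂ] DruryArveson d) : Prop :=
  ∀ (g : DruryArveson d) (z : UnitBall d), T g z = f z * g z

/-- The multiplier algebra of the Drury-Arveson space, as a set of functions on the ball. -/
def multiplierAlgebra (d : ℕ) : Set (UnitBall d → ℂ) :=
  {f | ∃ T, IsMultiplicationOp f T}

open Classical in
/-- The multiplication operator `M_f` of a multiplier `f` (zero if `f` is not a multiplier). It is
unique because elements of the space are determined by their values. -/
def mulOp {d : ℕ} (f : UnitBall d → ℂ) : DruryArveson d →L[ℂ] DruryArveson d :=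
  if h : ∃ T, IsMultiplicationOp f T then h.choose else 0

/-- The coordinate multiplication operators `M_{z_j}`. -/
def coordShift {d : ℕ} (j : Fin d) : DruryArveson d →L[ℂ] DruryArveson d :=
  mulOp fun z => (z : EuclideanSpace ℂ (Fin d)) j

/-- `M` is the (bounded) operator `M_b` of multiplication by the row `b = (b_1, …, b_N)`, from the
direct sum of `N` copies of the Drury-Arveson space to the Drury-Arveson space. -/
def IsRowMultiplicationOp {d N : ℕ} (b : UnitBall d → EuclideanSpace ℂ (Fin N))
    (M : PiLp 2 (fun _ : Fin N => DruryArveson d) →L[ℂ] DruryArveson d) : Prop :=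
  ∀ (G : PiLp 2 (fun _ : Fin N => DruryArveson d)) (z : UnitBall d),
    M G z = ∑ i, b z i * G i z

/-! ### Blaschke-type row multipliers -/

/-- The row `b(z) U A(z)`, where `A(z)` is the block diagonal matrix with blocks the row
`φ_λ(z)` of size `d` and the identity of size `k`. -/
def blaschkeStep {d k : ℕ} (b : UnitBall d → EuclideanSpace ℂ (Fin (k + 1)))
    (U : Matrix (Fin (k + 1)) (Fin (k + 1)) ℂ) (lam : UnitBall d) (z : UnitBall d) :
    EuclideanSpace ℂ (Fin (d + k)) :=
  WithLp.toLp 2 (Fin.append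
    (fun j : Fin d => Matrix.vecMul (b z).ofLp U 0 *
      ballInvolution (lam : EuclideanSpace ℂ (Fin d)) z j)
    (fun j : Fin k => Matrix.vecMul (b z).ofLp U j.succ))

/-- `IsBlaschkeRow l N b`: the row `b` of size `N` is obtained by the inductive construction from
the points of the list `l`, in this order, for some choice of the unitary matrices: it starts with
`φ_λ` for the first point, and each further point `lam` replaces the row `b` by
`b U diag(φ_lam, I)`, where `U` is a unitary matrix whose first column is `b(lam)^* / ‖b(lam)‖`. -/
inductive IsBlaschkeRow {d : ℕ} :
    List (UnitBall d) → (N : ℕ) → (UnitBall d → EuclideanSpace ℂ (Fin N)) → Prop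
  | single (lam : UnitBall d) :
      IsBlaschkeRow [lam] d fun z => ballInvolution (lam : EuclideanSpace ℂ (Fin d)) z
  | step {l : List (UnitBall d)} {k : ℕ} {b : UnitBall d → EuclideanSpace ℂ (Fin (k + 1))}
      (lam : UnitBall d) (U : Matrix (Fin (k + 1)) (Fin (k + 1)) ℂ)
      (hb : IsBlaschkeRow l (k + 1) b)
      (hU : U ∈ Matrix.unitaryGroup (Fin (k + 1)) ℂ)
      (hU0 : ∀ i, U i 0 = (starRingEnd ℂ) (b lam i) / (‖b lam‖ : ℂ)) :
      IsBlaschkeRow (l ++ [lam]) (d + k) (blaschkeStep b U lam)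

/-! ### Joint spectra of commuting tuples -/

section JointSpectrum

variable {d : ℕ} {V : Type*} [AddCommGroup V] [Module ℂ V]

/-- The joint spectrum of a commuting tuple on a finite-dimensional space. -/
def jointSpectrum (A : Fin d → Module.End ℂ V) : Set (EuclideanSpace ℂ (Fin d)) :=
  {lam | (⨅ j, LinearMap.ker (A j - lam j • (1 : Module.End ℂ V))) ≠ ⊥}

/-- The root subspace `⋂_{|α| = n} ker (A - λ)^α`, where `n` is the dimension of the space. -/
def rootSubspace (A : Fin d → Module.End ℂ V) (lam : EuclideanSpace ℂ (Fin d)) : Submodule ℂ V :=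
  ⨅ α : {α : Fin d → ℕ // ∑ j, α j = Module.finrank ℂ V},
    LinearMap.ker (List.ofFn fun j => (A j - lam j • (1 : Module.End ℂ V)) ^ (α.1 j)).prod

open Classical in
/-- `X` is the joint spectrum with multiplicities `∑_{λ ∈ σ(A)} dim R_λ(A) [λ]` of the tuple `A`,
and the joint spectrum is contained in the ball. -/
def IsJointSpectrumWithMult {n : ℕ} (A : Fin d → Module.End ℂ V) (X : SymPolyball d n) : Prop :=
  jointSpectrum A ⊆ Metric.ball 0 1 ∧
    ∀ lam : UnitBall d, Multiset.count lam X.1 =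
      if (lam : EuclideanSpace ℂ (Fin d)) ∈ jointSpectrum A then
        Module.finrank ℂ (rootSubspace A lam) else 0

end JointSpectrum

/-! ### The Grassmannian of coinvariant subspaces -/

/-- The orthogonal projections onto `n`-dimensional multiplier coinvariant subspaces of the
Drury-Arveson space, with the topology of the operator norm. -/
def coinvariantProj (d n : ℕ) : Set (DruryArveson d →L[ℂ] DruryArveson d) :=
  {P | P ∘L P = P ∧ ContinuousLinearMap.adjoint P = P ∧
    (∀ f ∈ multiplierAlgebra d, P ∘L ContinuousLinearMap.adjoint (mulOp f) ∘L P =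
      ContinuousLinearMap.adjoint (mulOp f) ∘L P) ∧
    FiniteDimensional ℂ (P : DruryArveson d →ₗ[ℂ] DruryArveson d).range ∧
    Module.finrank ℂ (P : DruryArveson d →ₗ[ℂ] DruryArveson d).range = n}

/-- The compression `P T|_{ran P}` of an operator to the range of `P`. -/
def compression {d : ℕ} (P T : DruryArveson d →L[ℂ] DruryArveson d) :
    Module.End ℂ (P : DruryArveson d →ₗ[ℂ] DruryArveson d).range :=
  (P : DruryArveson d →ₗ[ℂ] DruryArveson d).rangeRestrict ∘ₗ
    (T : DruryArveson d →ₗ[ℂ] DruryArveson d) ∘ₗ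
      (P : DruryArveson d →ₗ[ℂ] DruryArveson d).range.subtype

/-- The compression of the tuple `M_z` of coordinate multiplications to the range of `P`. -/
def compressedShift {d : ℕ} (P : DruryArveson d →L[ℂ] DruryArveson d) (j : Fin d) :
    Module.End ℂ (P : DruryArveson d →ₗ[ℂ] DruryArveson d).range :=
  compression P (coordShift j)

open Classical in
/-- The map `Ψ` sending `P` to the joint spectrum with multiplicities of the compression of `M_z`
to the range of `P`. (The value in the case where there is no such point of the symmetrized
polyball is irrelevant; this case does not occur.) -/
def Psi (d n : ℕ) (P : coinvariantProj d n) : SymPolyball d n :=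
  if h : ∃ X : SymPolyball d n, IsJointSpectrumWithMult (compressedShift P.1) X then h.choose
  else symmetrize fun _ => ⟨0, by simp⟩

/-- The preimage under `Ψ` of the configuration space of `n` distinct points. -/
def coinvariantProjDistinct (d n : ℕ) : Set (coinvariantProj d n) :=
  Psi d n ⁻¹' configSpace d n

end

/-!
By the identity `1 - ⟨φ_λ(z), φ_λ(w)⟩ = (1 - ‖λ‖²)(1 - ⟨z, w⟩) / ((1 - ⟨z, λ⟩)(1 - ⟨λ, w⟩))`, each
step of the construction of `b_X` subtracts from the kernel `(1 - ⟨b(z), b(w)⟩) k(z, w)` a rank-one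
term, exactly as in a Gram-Schmidt step on the kernel functions. Hence
`(1 - ⟨b_X(z), b_X(w)⟩) k(z, w)` is the kernel of the projection onto the span of
`k_{λ_1}, …, k_{λ_n}`, that is, `I - M_{b_X} M_{b_X}^*` is this projection; it depends continuously
on distinct points because the kernel functions are linearly independent.

The adjoints of the coordinate multipliers have the kernel functions as their only joint
eigenvectors, so `Ψ(P)` consists of the points whose kernel functions lie in the range of `P`, and
`P ∈ ℙ⁰` is the projection onto their span. For the continuity of `Ψ` let `x ∈ Ψ(P)` and let `Q` be
close to `P`. A product of `n` affine multipliers that vanish at the points of `Ψ(Q)` bounds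
`∏_{y ∈ Ψ(Q)} ‖x - y‖²` by a constant times `‖k_x - Q k_x‖ = ‖(P - Q) k_x‖`, so `x` is close to a
point of `Ψ(Q)`.
-/

open scoped InnerProductSpace

noncomputable section

/-! ### Joint spectra of commuting tuples -/

section Monomials

variable {M : Type*} [Monoid M] {d : ℕ}

theorem prod_ofFn_pow_single (N : Fin d → M) (i : Fin d) (m : ℕ) :
    (List.ofFn fun j => N j ^ (Pi.single i m : Fin d → ℕ) j).prod = N i ^ m := by
  induction d with
  | zero => exact i.elim0
  | succ d ih =>
    rw [List.ofFn_succ, List.prod_cons]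
    induction i using Fin.cases with
    | zero => simp [List.ofFn_const]
    | succ i =>
      have hsucc : ∀ j : Fin d, (Pi.single i.succ m : Fin (d + 1) → ℕ) j.succ =
          (Pi.single i m : Fin d → ℕ) j := fun j => by simp [Pi.single_apply]
      simp only [hsucc, ih fun j => N j.succ]
      simp

theorem prod_ofFn_pow_add {N : Fin d → M} (hN : ∀ i j, Commute (N i) (N j)) (α β : Fin d → ℕ) :
    (List.ofFn fun j => N j ^ (α + β) j).prod =
      (List.ofFn fun j => N j ^ α j).prod * (List.ofFn fun j => N j ^ β j).prod := by
  induction d with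
  | zero => simp
  | succ d ih =>
    have htail : Commute (N 0 ^ β 0) (List.ofFn fun j : Fin d => N j.succ ^ α j.succ).prod :=
      Commute.list_prod_right _ _ fun x hx => by
        obtain ⟨j, rfl⟩ := List.mem_ofFn.1 hx
        exact (hN 0 j.succ).pow_pow _ _
    simp only [List.ofFn_succ, List.prod_cons, Pi.add_apply, pow_add]
    have hrec := ih (fun i j => hN i.succ j.succ) (fun j => α j.succ) fun j => β j.succ
    simp only [Pi.add_apply, pow_add] at hrec
    rw [hrec, htail.mul_mul_mul_comm]

theorem prod_ofFn_pow_add_single {N : Fin d → M} (hN : ∀ i j, Commute (N i) (N j))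
    (α : Fin d → ℕ) (i : Fin d) :
    (List.ofFn fun j => N j ^ (α + Pi.single i 1 : Fin d → ℕ) j).prod =
      (List.ofFn fun j => N j ^ α j).prod * N i := by
  rw [prod_ofFn_pow_add hN, prod_ofFn_pow_single, pow_one]

end Monomials

theorem exists_eq_add_single {ι : Type*} [Fintype ι] [DecidableEq ι] {m : ℕ} {α : ι → ℕ}
    (hα : ∑ j, α j = m + 1) :
    ∃ (β : ι → ℕ) (i : ι), α = β + Pi.single i 1 ∧ ∑ j, β j = m := by
  obtain ⟨i, -, hi⟩ := Finset.exists_ne_zero_of_sum_ne_zero (hα.trans_ne m.succ_ne_zero)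
  have hle : (Pi.single i 1 : ι → ℕ) ≤ α := by
    intro j
    rcases eq_or_ne j i with rfl | hj
    · simpa using Nat.one_le_iff_ne_zero.2 hi
    · simp [hj]
  refine ⟨α - Pi.single i 1, i, (tsub_add_cancel_of_le hle).symm, ?_⟩
  have hsum : ∑ j, (α - Pi.single i 1 + Pi.single i 1 : ι → ℕ) j = m + 1 := by
    rwa [tsub_add_cancel_of_le hle]
  simp only [Pi.add_apply, Finset.sum_add_distrib, Finset.sum_pi_single', Finset.mem_univ,
    if_true] at hsum
  exact Nat.succ_injective hsum

section CommutingEndomorphisms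

variable {K V : Type*} [Field K] [AddCommGroup V] [Module K V] {d : ℕ}

theorem exists_ne_zero_forall_apply_eq_zero {N : Fin d → Module.End K V}
    (hN : ∀ i j, Commute (N i) (N j)) {m : ℕ} {v : V} (hv : v ≠ 0)
    (h : ∀ α : Fin d → ℕ, ∑ j, α j = m → (List.ofFn fun j => N j ^ α j).prod v = 0) :
    ∃ w : V, w ≠ 0 ∧ ∀ j, N j w = 0 := by
  induction m generalizing v with
  | zero => exact absurd (by simpa [List.ofFn_const] using h 0 (by simp)) hv
  | succ m ih =>
    by_cases hker : ∀ j, N j v = 0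
    · exact ⟨v, hv, hker⟩
    · push Not at hker
      obtain ⟨i, hi⟩ := hker
      refine ih hi fun α hα => ?_
      rw [← Module.End.mul_apply, ← prod_ofFn_pow_add_single hN]
      exact h _ (by simp [Finset.sum_add_distrib, hα])

theorem map_lt_of_forall_exists_pow_apply_eq_zero [FiniteDimensional K V] {T : Module.End K V}
    {W : Submodule K V} (hW : W ≠ ⊥) (hT : W.map T ≤ W)
    (hnil : ∀ w ∈ W, ∃ k : ℕ, (T ^ k) w = 0) : W.map T < W := by
  refine lt_of_le_of_ne hT fun hmap => hW ?_
  have hpow : ∀ k : ℕ, W.map (T ^ k) = W := by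
    intro k
    induction k with
    | zero => simp [Module.End.one_eq_id]
    | succ k ih => rw [pow_succ', Module.End.mul_eq_comp, Submodule.map_comp, ih, hmap]
  have hinj : ∀ w ∈ W, ∀ k : ℕ, (T ^ k) w = 0 → w = 0 := by
    intro w hw k hk
    have hmaps : ∀ u ∈ W, (T ^ k) u ∈ W := fun u hu => hpow k ▸ Submodule.mem_map_of_mem hu
    have hsurj : Function.Surjective ((T ^ k).restrict hmaps) := by
      rintro ⟨u, hu⟩
      obtain ⟨v, hv, rfl⟩ := (hpow k).ge hu
      exact ⟨⟨v, hv⟩, rfl⟩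
    have h0 := LinearMap.injective_iff_surjective.2 hsurj
      (a₁ := ⟨w, hw⟩) (a₂ := 0) (by rw [map_zero]; exact Subtype.ext hk)
    exact congrArg Subtype.val h0
  refine (Submodule.eq_bot_iff _).2 fun w hw => ?_
  obtain ⟨k, hk⟩ := hnil w hw
  exact hinj w hw k hk

theorem le_ker_prod_ofFn_pow [FiniteDimensional K V] {N : Fin d → Module.End K V}
    (hN : ∀ i j, Commute (N i) (N j)) {W : Submodule K V} (hW : ∀ j, W.map (N j) ≤ W)
    (hnil : ∀ j, ∀ w ∈ W, ∃ k : ℕ, (N j ^ k) w = 0) {α : Fin d → ℕ}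
    (hα : Module.finrank K W ≤ ∑ j, α j) :
    W ≤ LinearMap.ker (List.ofFn fun j => N j ^ α j).prod := by
  generalize hm : ∑ j, α j = m at hα
  induction m generalizing W α with
  | zero => rw [Submodule.finrank_eq_zero.1 (Nat.le_zero.1 hα)]; exact bot_le
  | succ m ih =>
    rcases eq_or_ne W ⊥ with rfl | hW0
    · exact bot_le
    obtain ⟨β, i, rfl, hβ⟩ := exists_eq_add_single hm
    have hlt := Submodule.finrank_lt_finrank_of_lt
      (map_lt_of_forall_exists_pow_apply_eq_zero hW0 (hW i) (hnil i))
    have hWi : ∀ j, (W.map (N i)).map (N j) ≤ W.map (N i) := fun j => by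
      rw [← Submodule.map_comp, ← Module.End.mul_eq_comp, (hN j i).eq, Module.End.mul_eq_comp,
        Submodule.map_comp]
      exact Submodule.map_mono (hW j)
    have hker := ih hWi (fun j w hw => hnil j w (hW i hw)) hβ (by lia)
    intro w hw
    rw [LinearMap.mem_ker, prod_ofFn_pow_add_single hN]
    exact hker (Submodule.mem_map_of_mem hw)

theorem commute_sub_smul_one {A B : Module.End K V} (h : Commute A B) (a b : K) :
    Commute (A - a • (1 : Module.End K V)) (B - b • (1 : Module.End K V)) :=
  (h.sub_right ((Commute.one_right _).smul_right _)).sub_left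
    ((Commute.one_left _).smul_left _)

theorem finrank_eq_sum_finrank_of_isInternal {ι : Type*} [DecidableEq ι] [FiniteDimensional K V]
    [CharZero K] {R : ι → Submodule K V} (hR : DirectSum.IsInternal R)
    (hfin : {i | R i ≠ ⊥}.Finite) :
    Module.finrank K V = ∑ i ∈ hfin.toFinset, Module.finrank K (R i) := by
  have htrace := LinearMap.trace_eq_sum_trace_restrict' hR hfin
    (f := (LinearMap.id : V →ₗ[K] V)) fun _ _ hv => hv
  have hid : ∀ i, LinearMap.restrict (p := R i) (q := R i) (LinearMap.id : V →ₗ[K] V)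
      (fun _ hv => hv) = LinearMap.id := fun _ => rfl
  simp only [hid, LinearMap.trace_id] at htrace
  exact_mod_cast htrace

end CommutingEndomorphisms

section JointSpectrum

variable {d : ℕ} {V : Type*} [AddCommGroup V] [Module ℂ V] {A : Fin d → Module.End ℂ V}

theorem mem_jointSpectrum_iff {lam : EuclideanSpace ℂ (Fin d)} :
    lam ∈ jointSpectrum A ↔ ∃ v : V, v ≠ 0 ∧ ∀ j, A j v = lam j • v := by
  simp only [jointSpectrum, Set.mem_ofPred_eq, Submodule.ne_bot_iff, Submodule.mem_iInf,
    LinearMap.mem_ker, LinearMap.sub_apply, LinearMap.smul_apply, Module.End.one_apply, sub_eq_zero,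
    and_comm]

variable [FiniteDimensional ℂ V] (hA : ∀ i j, Commute (A i) (A j))
include hA

theorem rootSubspace_eq_iInf_maxGenEigenspace (lam : EuclideanSpace ℂ (Fin d)) :
    rootSubspace A lam = ⨅ j, (A j).maxGenEigenspace (lam j) := by
  have hN : ∀ i j, Commute (A i - lam i • (1 : Module.End ℂ V)) (A j - lam j • 1) :=
    fun i j => commute_sub_smul_one (hA i j) _ _
  refine le_antisymm (le_iInf fun j v hv => ?_) (le_iInf fun α => ?_)
  · have hv' := (Submodule.mem_iInf _).1 hv ⟨Pi.single j (Module.finrank ℂ V), by simp⟩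
    rw [LinearMap.mem_ker, prod_ofFn_pow_single fun i => A i - lam i • (1 : Module.End ℂ V)] at hv'
    exact (Module.End.mem_maxGenEigenspace _ _ _).2 ⟨_, hv'⟩
  · refine le_ker_prod_ofFn_pow hN (fun i => ?_) (fun j w hw => ?_)
      ((Submodule.finrank_le _).trans_eq α.2.symm)
    · rintro _ ⟨w, hw, rfl⟩
      refine (Submodule.mem_iInf _).2 fun j => ?_
      exact Module.End.mapsTo_maxGenEigenspace_of_comm
        ((hA j i).sub_right ((Commute.one_right _).smul_right _)) _ ((Submodule.mem_iInf _).1 hw j)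
    · exact (Module.End.mem_maxGenEigenspace _ _ _).1 ((Submodule.mem_iInf _).1 hw j)

theorem mem_jointSpectrum_iff_rootSubspace_ne_bot {lam : EuclideanSpace ℂ (Fin d)} :
    lam ∈ jointSpectrum A ↔ rootSubspace A lam ≠ ⊥ := by
  constructor
  · intro hlam
    obtain ⟨v, hv0, hv⟩ := mem_jointSpectrum_iff.1 hlam
    rw [rootSubspace_eq_iInf_maxGenEigenspace hA]
    refine (Submodule.ne_bot_iff _).2 ⟨v, (Submodule.mem_iInf _).2 fun j => ?_, hv0⟩
    exact (Module.End.mem_maxGenEigenspace _ _ _).2 ⟨1, by simp [hv j]⟩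
  · intro hne
    obtain ⟨v, hv, hv0⟩ := (Submodule.ne_bot_iff _).1 hne
    obtain ⟨w, hw0, hw⟩ := exists_ne_zero_forall_apply_eq_zero
      (N := fun j => A j - lam j • (1 : Module.End ℂ V))
      (fun i j => commute_sub_smul_one (hA i j) _ _) hv0
      fun α hα => (Submodule.mem_iInf _).1 hv ⟨α, hα⟩
    exact mem_jointSpectrum_iff.2 ⟨w, hw0, fun j => sub_eq_zero.1 (hw j)⟩

theorem iSup_rootSubspace_eq_top : ⨆ lam, rootSubspace A lam = ⊤ := by
  have htop : ⨆ χ : Fin d → ℂ, ⨅ i, (A i).maxGenEigenspace (χ i) = ⊤ :=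
    Module.End.iSup_iInf_maxGenEigenspace_eq_top_of_iSup_maxGenEigenspace_eq_top_of_commute A
      (fun i j _ => hA i j) fun i => Module.End.iSup_maxGenEigenspace_eq_top (A i)
  simp only [rootSubspace_eq_iInf_maxGenEigenspace hA]
  rw [← htop]
  exact (WithLp.equiv 2 (Fin d → ℂ)).iSup_congr fun _ => rfl

theorem isInternal_rootSubspace {S : Set (EuclideanSpace ℂ (Fin d))} (hS : jointSpectrum A ⊆ S) :
    DirectSum.IsInternal fun lam : S => rootSubspace A lam := by
  classical
  refine DirectSum.isInternal_submodule_of_iSupIndep_of_iSup_eq_top ?_ ?_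
  · have hind := Module.End.independent_iInf_maxGenEigenspace_of_forall_mapsTo A
      fun i j φ => Module.End.mapsTo_maxGenEigenspace_of_comm (hA j i) φ
    simp only [rootSubspace_eq_iInf_maxGenEigenspace hA]
    exact hind.comp ((WithLp.ofLp_injective 2).comp Subtype.val_injective)
  · rw [← top_le_iff, ← iSup_rootSubspace_eq_top hA]
    refine iSup_le fun lam => ?_
    by_cases hlam : lam ∈ jointSpectrum A
    · exact le_iSup (fun mu : S => rootSubspace A mu) ⟨lam, hS hlam⟩
    · rw [mem_jointSpectrum_iff_rootSubspace_ne_bot hA, not_not] at hlam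
      rw [hlam]
      exact bot_le

theorem exists_isJointSpectrumWithMult {n : ℕ} (hn : Module.finrank ℂ V = n)
    (hσ : jointSpectrum A ⊆ Metric.ball 0 1) :
    ∃ X : SymPolyball d n, IsJointSpectrumWithMult A X := by
  classical
  have hint := isInternal_rootSubspace hA hσ
  have hfin : {lam : UnitBall d | rootSubspace A lam ≠ ⊥}.Finite :=
    WellFoundedGT.finite_ne_bot_of_iSupIndep hint.submodule_iSupIndep
  let f : UnitBall d →₀ ℕ := Finsupp.onFinset hfin.toFinset
    (fun lam => Module.finrank ℂ (rootSubspace A lam)) fun lam hlam =>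
      hfin.mem_toFinset.2 fun hbot => hlam (Submodule.finrank_eq_zero.2 hbot)
  have hcard : Multiset.card (Finsupp.toMultiset f) = n := by
    rw [Finsupp.card_toMultiset, ← hn, finrank_eq_sum_finrank_of_isInternal hint hfin]
    exact Finsupp.onFinset_sum _ fun _ => rfl
  refine ⟨⟨Finsupp.toMultiset f, hcard⟩, hσ, fun lam => ?_⟩
  rw [Finsupp.count_toMultiset]
  split_ifs with hlam
  · rfl
  · rw [mem_jointSpectrum_iff_rootSubspace_ne_bot hA, not_not] at hlam
    exact Submodule.finrank_eq_zero.2 hlam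

theorem apply_eq_zero_of_mem_rootSubspace {f : V →ₗ[ℂ] ℂ} {c : Fin d → ℂ}
    (hf : ∀ j v, f (A j v) = c j * f v) {lam : EuclideanSpace ℂ (Fin d)} {v : V}
    (hv : v ∈ rootSubspace A lam) (hlam : lam.ofLp ≠ c) : f v = 0 := by
  obtain ⟨j, hj⟩ := Function.ne_iff.1 hlam
  rw [rootSubspace_eq_iInf_maxGenEigenspace hA] at hv
  obtain ⟨k, hk⟩ := (Module.End.mem_maxGenEigenspace _ _ _).1 ((Submodule.mem_iInf _).1 hv j)
  have hpow : ∀ (k : ℕ) (w : V),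
      f (((A j - lam j • (1 : Module.End ℂ V)) ^ k) w) = (c j - lam j) ^ k * f w := by
    intro k
    induction k with
    | zero => simp
    | succ k ih =>
      intro w
      rw [pow_succ, Module.End.mul_apply, ih]
      simp only [LinearMap.sub_apply, LinearMap.smul_apply, Module.End.one_apply, map_sub, map_smul,
        hf, smul_eq_mul]
      ring
  have hzero := hpow k v
  rw [hk, map_zero] at hzero
  exact (mul_eq_zero.1 hzero.symm).resolve_left (pow_ne_zero _ (sub_ne_zero.2 hj.symm))

theorem mem_jointSpectrum_of_functional {f : V →ₗ[ℂ] ℂ} (hf0 : f ≠ 0)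
    {lam : EuclideanSpace ℂ (Fin d)} (hf : ∀ j v, f (A j v) = lam j * f v) :
    lam ∈ jointSpectrum A := by
  rw [mem_jointSpectrum_iff_rootSubspace_ne_bot hA]
  intro hbot
  have hker : ⨆ mu, rootSubspace A mu ≤ LinearMap.ker f := by
    refine iSup_le fun mu v hv => ?_
    by_cases hmu : mu.ofLp = lam.ofLp
    · obtain rfl : mu = lam := WithLp.ofLp_injective 2 hmu
      rw [hbot, Submodule.mem_bot] at hv
      rw [hv]
      exact zero_mem _
    · exact apply_eq_zero_of_mem_rootSubspace hA hf hv hmu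
  rw [iSup_rootSubspace_eq_top hA] at hker
  exact hf0 (LinearMap.ext fun v => hker trivial)

end JointSpectrum

section AdjointEigenvectors

variable {d : ℕ} {E : Type*} [NormedAddCommGroup E] [InnerProductSpace ℂ E] [FiniteDimensional ℂ E]

theorem mem_jointSpectrum_of_adjoint_apply_eq {A : Fin d → Module.End ℂ E}
    (hA : ∀ i j, Commute (A i) (A j)) {lam : EuclideanSpace ℂ (Fin d)} {v : E} (hv0 : v ≠ 0)
    (hv : ∀ j, LinearMap.adjoint (A j) v = (starRingEnd ℂ) (lam j) • v) :
    lam ∈ jointSpectrum A := by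
  refine mem_jointSpectrum_of_functional hA (f := (innerSL ℂ v : E →L[ℂ] ℂ)) ?_ fun j w => ?_
  · exact fun h0 => hv0 (inner_self_eq_zero.1 (LinearMap.congr_fun h0 v))
  · simp [← LinearMap.adjoint_inner_left, hv, inner_smul_left]

theorem mem_jointSpectrum_iff_adjoint {A : Fin d → Module.End ℂ E}
    (hA : ∀ i j, Commute (A i) (A j)) {lam : EuclideanSpace ℂ (Fin d)} :
    lam ∈ jointSpectrum A ↔
      ∃ v : E, v ≠ 0 ∧ ∀ j, LinearMap.adjoint (A j) v = (starRingEnd ℂ) (lam j) • v := by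
  refine ⟨fun hlam => ?_, fun ⟨v, hv0, hv⟩ => mem_jointSpectrum_of_adjoint_apply_eq hA hv0 hv⟩
  obtain ⟨v, hv0, hv⟩ := mem_jointSpectrum_iff.1 hlam
  have hstar := mem_jointSpectrum_of_adjoint_apply_eq
    (A := fun j => LinearMap.adjoint (A j)) (lam := WithLp.toLp 2 fun j => (starRingEnd ℂ) (lam j))
    (fun i j => commute_star_star.2 (hA i j)) hv0 fun j => by simpa using hv j
  exact mem_jointSpectrum_iff.1 hstar

end AdjointEigenvectors

/-! ### Operators on Hilbert spaces -/

section Hilbert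

variable {𝕜 H E : Type*} [RCLike 𝕜] [NormedAddCommGroup H] [InnerProductSpace 𝕜 H]
  [NormedAddCommGroup E] [InnerProductSpace 𝕜 E]

theorem starProjection_sup_of_isOrtho {K L : Submodule 𝕜 H} [K.HasOrthogonalProjection]
    [L.HasOrthogonalProjection] [(K ⊔ L).HasOrthogonalProjection] (h : K ⟂ L) :
    (K ⊔ L).starProjection = K.starProjection + L.starProjection := by
  ext x
  refine Submodule.eq_starProjection_of_mem_orthogonal
    (add_mem (Submodule.mem_sup_left (K.starProjection_apply_mem x))
      (Submodule.mem_sup_right (L.starProjection_apply_mem x))) ?_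
  rw [← Submodule.inf_orthogonal]
  refine ⟨?_, ?_⟩
  · rw [add_apply, ← sub_sub]
    exact sub_mem (Submodule.sub_starProjection_mem_orthogonal x)
      (h.ge (L.starProjection_apply_mem x))
  · rw [add_apply, add_comm, ← sub_sub]
    exact sub_mem (Submodule.sub_starProjection_mem_orthogonal x)
      (h.le (K.starProjection_apply_mem x))

theorem sup_span_starProjection_orthogonal (K : Submodule 𝕜 H) [K.HasOrthogonalProjection]
    (v : H) : K ⊔ Submodule.span 𝕜 {Kᗮ.starProjection v} = K ⊔ Submodule.span 𝕜 {v} := by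
  have hdiff : K.starProjection v ∈ K := K.starProjection_apply_mem v
  rw [Submodule.starProjection_orthogonal_val]
  refine le_antisymm (sup_le le_sup_left ?_) (sup_le le_sup_left ?_) <;>
    rw [Submodule.span_singleton_le_iff_mem]
  · exact sub_mem (Submodule.mem_sup_right (Submodule.mem_span_singleton_self v))
      (Submodule.mem_sup_left hdiff)
  · rw [← sub_add_cancel v (K.starProjection v)]
    exact add_mem (Submodule.mem_sup_right (by simp))
      (Submodule.mem_sup_left hdiff)

theorem starProjection_sup_span_singleton (K : Submodule 𝕜 H) [K.HasOrthogonalProjection] (v : H)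
    [(K ⊔ Submodule.span 𝕜 {v}).HasOrthogonalProjection] :
    (K ⊔ Submodule.span 𝕜 {v}).starProjection =
      K.starProjection + (Submodule.span 𝕜 {Kᗮ.starProjection v}).starProjection := by
  have hortho : K ⟂ Submodule.span 𝕜 {Kᗮ.starProjection v} :=
    (Submodule.isOrtho_orthogonal_right K).mono_right
      ((Submodule.span_singleton_le_iff_mem _ _).2 (Kᗮ.starProjection_apply_mem v))
  simp only [← sup_span_starProjection_orthogonal K v]
  have : (K ⊔ Submodule.span 𝕜 {Kᗮ.starProjection v}).HasOrthogonalProjection := by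
    rwa [sup_span_starProjection_orthogonal]
  exact starProjection_sup_of_isOrtho hortho

theorem inner_starProjection_starProjection (K : Submodule 𝕜 H) [K.HasOrthogonalProjection]
    (x y : H) : ⟪K.starProjection x, K.starProjection y⟫_𝕜 = ⟪x, K.starProjection y⟫_𝕜 := by
  rw [K.inner_starProjection_left_eq_right,
    Submodule.starProjection_eq_self_iff.2 (K.starProjection_apply_mem y)]

theorem inner_starProjection_orthogonal_sup_span_singleton (K : Submodule 𝕜 H)
    [K.HasOrthogonalProjection] (v : H) [(K ⊔ Submodule.span 𝕜 {v}).HasOrthogonalProjection]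
    (x y : H) :
    ⟪(K ⊔ Submodule.span 𝕜 {v})ᗮ.starProjection x, (K ⊔ Submodule.span 𝕜 {v})ᗮ.starProjection y⟫_𝕜 =
      ⟪Kᗮ.starProjection x, Kᗮ.starProjection y⟫_𝕜 -
        ⟪Kᗮ.starProjection x, Kᗮ.starProjection v⟫_𝕜 *
          ⟪Kᗮ.starProjection v, Kᗮ.starProjection y⟫_𝕜 /
          ⟪Kᗮ.starProjection v, Kᗮ.starProjection v⟫_𝕜 := by
  have hleft : ⟪Kᗮ.starProjection v, Kᗮ.starProjection y⟫_𝕜 = ⟪Kᗮ.starProjection v, y⟫_𝕜 := by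
    rw [inner_starProjection_starProjection, Kᗮ.inner_starProjection_left_eq_right]
  rw [inner_starProjection_starProjection, inner_starProjection_starProjection,
    inner_starProjection_starProjection Kᗮ x v, hleft, Submodule.starProjection_orthogonal_val,
    starProjection_sup_span_singleton, add_apply, ← sub_sub,
    ← Submodule.starProjection_orthogonal_val, inner_sub_right, Submodule.starProjection_singleton,
    inner_smul_right, inner_self_eq_norm_sq_to_K, RCLike.ofReal_pow]
  ring

theorem continuousAt_starProjection_span_singleton {u : H} (hu : u ≠ 0) :
    ContinuousAt (fun v : H => (Submodule.span 𝕜 {v}).starProjection) u := by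
  have hformula : (fun v : H => (Submodule.span 𝕜 {v}).starProjection) =
      fun v => ((‖v‖ : 𝕜) ^ 2)⁻¹ • (innerSL 𝕜 v).smulRight v := by
    ext v x
    simp [Submodule.starProjection_singleton, smul_smul, div_eq_inv_mul]
  have hnorm : ContinuousAt (fun v : H => ((‖v‖ : 𝕜) ^ 2)⁻¹) u :=
    ContinuousAt.inv₀ (by fun_prop) (by simpa using hu)
  rw [hformula]
  exact hnorm.smul (((ContinuousLinearMap.smulRightL 𝕜 H H).continuous.comp
    (innerSL 𝕜).continuous).clm_apply continuous_id).continuousAt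

variable [CompleteSpace H] [CompleteSpace E]

theorem exists_adjoint_comp_self_eq {ι : Type*} {e : ι → H}
    (he : Dense (Submodule.span 𝕜 (Set.range e) : Set H)) {v : ι → E} {Q : H →L[𝕜] H}
    (h : ∀ i j, ⟪v i, v j⟫_𝕜 = ⟪e i, Q (e j)⟫_𝕜) :
    ∃ T : H →L[𝕜] E, (∀ i, T (e i) = v i) ∧ ContinuousLinearMap.adjoint T ∘L T = Q := by
  have hdense : DenseRange (Finsupp.linearCombination 𝕜 e) := by
    rwa [DenseRange, ← LinearMap.coe_range, Finsupp.range_linearCombination]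
  have hgram : ∀ c, ⟪Finsupp.linearCombination 𝕜 v c, Finsupp.linearCombination 𝕜 v c⟫_𝕜 =
      ⟪Finsupp.linearCombination 𝕜 e c, Q (Finsupp.linearCombination 𝕜 e c)⟫_𝕜 := by
    intro c
    simp only [Finsupp.linearCombination_apply, Finsupp.sum, map_sum, sum_inner, inner_sum,
      map_smul, inner_smul_left, inner_smul_right, h]
  have hbound : ∀ c, ‖Finsupp.linearCombination 𝕜 v c‖ ≤
      √‖Q‖ * ‖Finsupp.linearCombination 𝕜 e c‖ := by
    intro c
    set x := Finsupp.linearCombination 𝕜 e c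
    rw [← pow_le_pow_iff_left₀ (norm_nonneg _) (by positivity) two_ne_zero, mul_pow,
      Real.sq_sqrt (norm_nonneg Q), norm_sq_eq_re_inner (𝕜 := 𝕜), hgram]
    calc RCLike.re ⟪x, Q x⟫_𝕜 ≤ ‖x‖ * ‖Q x‖ := re_inner_le_norm _ _
      _ ≤ ‖x‖ * (‖Q‖ * ‖x‖) := by gcongr; exact Q.le_opNorm x
      _ = ‖Q‖ * ‖x‖ ^ 2 := by ring
  let T := (Finsupp.linearCombination 𝕜 v).extendOfNorm (Finsupp.linearCombination 𝕜 e)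
  have hT : ∀ i, T (e i) = v i := fun i => by
    simpa using LinearMap.extendOfNorm_eq hdense ⟨_, hbound⟩ (Finsupp.single i 1)
  refine ⟨T, hT, ContinuousLinearMap.ext_on he ?_⟩
  rintro _ ⟨j, rfl⟩
  refine hdense.eq_of_inner_right 𝕜 fun c => ?_
  simp [Finsupp.linearCombination_apply, Finsupp.sum, sum_inner, inner_smul_left,
    ContinuousLinearMap.adjoint_inner_right, hT, h]

theorem comp_starProjection_of_adjoint_comp_self {K : Submodule 𝕜 H} [K.HasOrthogonalProjection]
    {T : H →L[𝕜] E} (hT : ContinuousLinearMap.adjoint T ∘L T = K.starProjection) :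
    T ∘L K.starProjection = T := by
  ext x
  have hzero : ⟪T (x - K.starProjection x), T (x - K.starProjection x)⟫_𝕜 = 0 := by
    rw [← ContinuousLinearMap.adjoint_inner_right, ← ContinuousLinearMap.comp_apply, hT]
    exact Submodule.starProjection_inner_eq_zero x _ (K.starProjection_apply_mem _)
  rw [inner_self_eq_zero, map_sub, sub_eq_zero] at hzero
  exact hzero.symm

section PartialIsometry

variable {K : Submodule 𝕜 H} [K.HasOrthogonalProjection] {M : E →L[𝕜] H}
  (hM : M ∘L ContinuousLinearMap.adjoint M = K.starProjection)
include hM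

theorem starProjection_comp_of_comp_adjoint : K.starProjection ∘L M = M := by
  have hadj := comp_starProjection_of_adjoint_comp_self
    (T := ContinuousLinearMap.adjoint M) (by rwa [ContinuousLinearMap.adjoint_adjoint])
  simpa [ContinuousLinearMap.adjoint_comp, (isSelfAdjoint_starProjection K).adjoint_eq] using
    congrArg ContinuousLinearMap.adjoint hadj

theorem comp_adjoint_comp_self_of_comp_adjoint : M ∘L ContinuousLinearMap.adjoint M ∘L M = M := by
  rw [← ContinuousLinearMap.comp_assoc, hM, starProjection_comp_of_comp_adjoint hM]

theorem range_eq_of_comp_adjoint : (M : E →ₗ[𝕜] H).range = K := by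
  refine le_antisymm ?_ fun x hx => ?_
  · rintro _ ⟨y, rfl⟩
    rw [← starProjection_comp_of_comp_adjoint hM]
    exact K.starProjection_apply_mem (M y)
  · rw [← Submodule.starProjection_eq_self_iff.2 hx, ← hM]
    exact ⟨ContinuousLinearMap.adjoint M x, rfl⟩

end PartialIsometry

end Hilbert

/-! ### Kernel functions of the Drury–Arveson space -/

theorem continuous_of_continuous_inner (𝕜 : Type*) {X H : Type*} [RCLike 𝕜] [TopologicalSpace X]
    [NormedAddCommGroup H] [InnerProductSpace 𝕜 H] {f : X → H}
    (hf : Continuous fun p : X × X => ⟪f p.1, f p.2⟫_𝕜) : Continuous f := by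
  refine continuous_iff_continuousAt.2 fun w => tendsto_iff_norm_sub_tendsto_zero.2 ?_
  have hexpand : ∀ z, ‖f z - f w‖ =
      √(RCLike.re (⟪f z, f z⟫_𝕜 - ⟪f z, f w⟫_𝕜 - (⟪f w, f z⟫_𝕜 - ⟪f w, f w⟫_𝕜))) := by
    intro z
    rw [← inner_sub_right, ← inner_sub_right, ← inner_sub_left, ← norm_sq_eq_re_inner,
      Real.sqrt_sq (norm_nonneg _)]
  have hcont : Continuous fun z => ‖f z - f w‖ := by
    simp_rw [hexpand]
    exact Real.continuous_sqrt.comp (RCLike.continuous_re.comp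
      (((hf.comp (continuous_id.prodMk continuous_id)).sub
        (hf.comp (continuous_id.prodMk continuous_const))).sub
        ((hf.comp (continuous_const.prodMk continuous_id)).sub continuous_const)))
  simpa using hcont.tendsto w

theorem hasSum_sum_piAntidiag {ι E : Type*} [Fintype ι] [DecidableEq ι] [AddCommMonoid E]
    [TopologicalSpace E] [ContinuousAdd E] [RegularSpace E] {f : (ι → ℕ) → E} {s : E}
    (h : HasSum f s) : HasSum (fun m => ∑ α ∈ Finset.piAntidiag Finset.univ m, f α) s := by
  rw [← (Equiv.sigmaFiberEquiv fun α : ι → ℕ => ∑ j, α j).hasSum_iff] at h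
  refine h.sigma fun m => ?_
  let e : {α : ι → ℕ // ∑ j, α j = m} ≃ {α // α ∈ Finset.piAntidiag Finset.univ m} :=
    Equiv.subtypeEquivRight fun α => by simp [Finset.mem_piAntidiag]
  exact e.hasSum_iff.2 (Finset.hasSum _ f)

section Ball

variable {d : ℕ}

theorem norm_coe_unitBall_lt_one (z : UnitBall d) : ‖(z : EuclideanSpace ℂ (Fin d))‖ < 1 :=
  mem_ball_zero_iff.1 z.2

theorem norm_inner_unitBall_lt_one (w z : UnitBall d) :
    ‖⟪(w : EuclideanSpace ℂ (Fin d)), z⟫_ℂ‖ < 1 :=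
  (norm_inner_le_norm _ _).trans_lt (mul_lt_one_of_nonneg_of_lt_one_left (norm_nonneg _)
    (norm_coe_unitBall_lt_one w) (norm_coe_unitBall_lt_one z).le)

theorem one_sub_inner_unitBall_ne_zero (w z : UnitBall d) :
    1 - ⟪(w : EuclideanSpace ℂ (Fin d)), z⟫_ℂ ≠ 0 := by
  intro h
  have hlt := norm_inner_unitBall_lt_one w z
  rw [← sub_eq_zero.1 h, norm_one] at hlt
  exact hlt.false

theorem inner_eq_sum_conj_mul (w z : EuclideanSpace ℂ (Fin d)) :
    ⟪w, z⟫_ℂ = ∑ j, (starRingEnd ℂ) (w j) * z j := by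
  simp [PiLp.inner_apply, mul_comm]

end Ball

namespace DruryArveson

variable {d : ℕ}

theorem apply_eq_inner (f : DruryArveson d) (z : UnitBall d) : f z = ⟪kernelVec z, f⟫_ℂ := rfl

theorem kerFun_one (z : UnitBall d) : RKHS.kerFun (DruryArveson d) z 1 = kernelVec z := by
  refine ext_inner_right ℂ fun f => ?_
  rw [RKHS.kerFun_inner, ← apply_eq_inner]
  simp

theorem factorial_div_prod_factorial (α : Fin d → ℕ) :
    ((∑ j, α j).factorial : ℝ) / ∏ j, ((α j).factorial : ℝ) =
      Nat.multinomial Finset.univ α := by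
  rw [div_eq_iff (by positivity), mul_comm]
  exact_mod_cast (Nat.multinomial_spec Finset.univ α).symm

theorem conj_normMonomial_mul (α : Fin d → ℕ) (w z : EuclideanSpace ℂ (Fin d)) :
    (starRingEnd ℂ) (normMonomial α w) * normMonomial α z =
      Nat.multinomial Finset.univ α * ∏ j, ((starRingEnd ℂ) (w j) * z j) ^ α j := by
  have hsqrt : ((√(Nat.multinomial Finset.univ α) : ℝ) : ℂ) * (√(Nat.multinomial Finset.univ α) : ℝ)
      = Nat.multinomial Finset.univ α := by
    rw [← Complex.ofReal_mul, Real.mul_self_sqrt (Nat.cast_nonneg _), Complex.ofReal_natCast]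
  simp only [normMonomial, factorial_div_prod_factorial, map_mul, Complex.conj_ofReal, map_prod,
    map_pow, mul_pow, Finset.prod_mul_distrib]
  rw [← hsqrt]
  ring

theorem inner_kernelVec (z w : UnitBall d) :
    ⟪kernelVec z, kernelVec w⟫_ℂ = (1 - ⟪(w : EuclideanSpace ℂ (Fin d)), z⟫_ℂ)⁻¹ := by
  have hgrade : ∀ m : ℕ, ∑ α ∈ Finset.piAntidiag Finset.univ m,
      coeff (kernelVec w) α * normMonomial α z = ⟪(w : EuclideanSpace ℂ (Fin d)), z⟫_ℂ ^ m := by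
    intro m
    rw [inner_eq_sum_conj_mul, Finset.sum_pow_eq_sum_piAntidiag]
    exact Finset.sum_congr rfl fun α _ => conj_normMonomial_mul α w z
  have hsum := hasSum_sum_piAntidiag (hasSum_evalAt (kernelVec w) z)
  simp_rw [hgrade] at hsum
  exact hsum.unique (hasSum_geometric_of_norm_lt_one (norm_inner_unitBall_lt_one w z))

theorem kernelVec_ne_zero (z : UnitBall d) : kernelVec z ≠ 0 := by
  intro h
  have hinner := inner_kernelVec z z
  rw [h, inner_zero_left] at hinner
  exact inv_ne_zero (one_sub_inner_unitBall_ne_zero z z) hinner.symm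

theorem continuous_kernelVec : Continuous (kernelVec (d := d)) := by
  refine continuous_of_continuous_inner ℂ ?_
  simp_rw [inner_kernelVec]
  exact Continuous.inv₀ (by fun_prop) fun p => one_sub_inner_unitBall_ne_zero p.2 p.1

theorem dense_span_range_kernelVec :
    Dense (Submodule.span ℂ (Set.range (kernelVec (d := d))) : Set (DruryArveson d)) := by
  rw [Submodule.dense_iff_topologicalClosure_eq_top, Submodule.topologicalClosure_eq_top_iff,
    Submodule.eq_bot_iff]
  refine fun f hf => RKHS.ext (𝕜 := ℂ) (X := UnitBall d) (V := ℂ) fun z => ?_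
  rw [apply_eq_inner, apply_eq_inner, inner_zero_right]
  exact hf _ (Submodule.subset_span ⟨z, rfl⟩)

end DruryArveson

open DruryArveson

/-! ### The involutions of the ball -/

section Involution

variable {d : ℕ}

theorem inner_sub_lineProj (lam z : EuclideanSpace ℂ (Fin d)) :
    ⟪lam, z - lineProj lam z⟫_ℂ = 0 := by
  rcases eq_or_ne lam 0 with rfl | h
  · exact inner_zero_left _
  · have hnorm : (‖lam‖ : ℂ) ≠ 0 := by simpa using h
    rw [lineProj, inner_sub_right, inner_smul_right, inner_self_eq_norm_sq_to_K]
    exact sub_eq_zero.2 (div_mul_cancel₀ _ (pow_ne_zero 2 hnorm)).symm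

theorem inner_sub_lineProj_sub_lineProj (lam w z : EuclideanSpace ℂ (Fin d)) :
    ⟪w - lineProj lam w, z - lineProj lam z⟫_ℂ =
      ⟪w, z⟫_ℂ - ⟪w, lam⟫_ℂ * ⟪lam, z⟫_ℂ / (‖lam‖ : ℂ) ^ 2 := by
  have hline : ⟪lineProj lam w, z - lineProj lam z⟫_ℂ = 0 := by
    rw [lineProj, inner_smul_left, inner_sub_lineProj, mul_zero]
  rw [inner_sub_left, hline, sub_zero, inner_sub_right, lineProj, inner_smul_right]
  ring

theorem inner_involution_numerator {lam : EuclideanSpace ℂ (Fin d)} (hlam : ‖lam‖ ≤ 1)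
    (w z : EuclideanSpace ℂ (Fin d)) :
    ⟪lam - lineProj lam w - (√(1 - ‖lam‖ ^ 2) : ℂ) • (w - lineProj lam w),
      lam - lineProj lam z - (√(1 - ‖lam‖ ^ 2) : ℂ) • (z - lineProj lam z)⟫_ℂ =
      (1 - ⟪w, lam⟫_ℂ) * (1 - ⟪lam, z⟫_ℂ) - (1 - ⟪lam, lam⟫_ℂ) * (1 - ⟪w, z⟫_ℂ) := by
  rcases eq_or_ne lam 0 with rfl | h
  · simp [lineProj]
  have hnorm : (‖lam‖ : ℂ) ≠ 0 := by simpa using h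
  have hsqrt : (√(1 - ‖lam‖ ^ 2) : ℂ) * (√(1 - ‖lam‖ ^ 2) : ℂ) = 1 - (‖lam‖ : ℂ) ^ 2 := by
    rw [← Complex.ofReal_mul, Real.mul_self_sqrt (by nlinarith [norm_nonneg lam])]
    simp
  have hline : ∀ x, lam - lineProj lam x = (1 - ⟪lam, x⟫_ℂ / (‖lam‖ : ℂ) ^ 2) • lam := fun x => by
    rw [lineProj, sub_smul, one_smul]
  have hleft : ⟪w - lineProj lam w, lam⟫_ℂ = 0 := inner_eq_zero_symm.1 (inner_sub_lineProj lam w)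
  rw [hline, hline, inner_sub_left, inner_sub_right, inner_sub_right]
  simp only [inner_smul_left, inner_smul_right, inner_sub_lineProj, hleft,
    inner_sub_lineProj_sub_lineProj, inner_self_eq_norm_sq_to_K, Complex.coe_algebraMap, map_sub,
    map_div₀, map_one, map_pow, Complex.conj_ofReal, inner_conj_symm]
  calc _ = (‖lam‖ : ℂ) ^ 2 * (1 - ⟪w, lam⟫_ℂ / (‖lam‖ : ℂ) ^ 2) * (1 - ⟪lam, z⟫_ℂ / (‖lam‖ : ℂ) ^ 2)
        + (√(1 - ‖lam‖ ^ 2) : ℂ) * (√(1 - ‖lam‖ ^ 2) : ℂ) *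
          (⟪w, z⟫_ℂ - ⟪w, lam⟫_ℂ * ⟪lam, z⟫_ℂ / (‖lam‖ : ℂ) ^ 2) := by ring
    _ = _ := by
      rw [hsqrt]
      field_simp
      ring

theorem one_sub_inner_ballInvolution (lam z w : UnitBall d) :
    1 - ⟪ballInvolution (lam : EuclideanSpace ℂ (Fin d)) w,
        ballInvolution (lam : EuclideanSpace ℂ (Fin d)) z⟫_ℂ =
      (1 - ⟪(lam : EuclideanSpace ℂ (Fin d)), lam⟫_ℂ) *
        (1 - ⟪(w : EuclideanSpace ℂ (Fin d)), z⟫_ℂ) /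
        ((1 - ⟪(w : EuclideanSpace ℂ (Fin d)), lam⟫_ℂ) *
          (1 - ⟪(lam : EuclideanSpace ℂ (Fin d)), z⟫_ℂ)) := by
  have hz := one_sub_inner_unitBall_ne_zero lam z
  have hw := one_sub_inner_unitBall_ne_zero w lam
  simp only [ballInvolution]
  rw [inner_smul_left, inner_smul_right,
    inner_involution_numerator (norm_coe_unitBall_lt_one lam).le, map_inv₀, map_sub, map_one,
    inner_conj_symm]
  field_simp
  ring

end Involution

/-! ### Blaschke rows -/

section RowMultiplier

variable {d N : ℕ} {b : UnitBall d → EuclideanSpace ℂ (Fin N)}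

theorem isRowMultiplicationOp_iff
    {M : PiLp 2 (fun _ : Fin N => DruryArveson d) →L[ℂ] DruryArveson d} :
    IsRowMultiplicationOp b M ↔ ∀ z, ContinuousLinearMap.adjoint M (kernelVec z) =
      WithLp.toLp 2 fun i => (starRingEnd ℂ) (b z i) • kernelVec z := by
  have hinner : ∀ z (G : PiLp 2 (fun _ : Fin N => DruryArveson d)),
      ⟪WithLp.toLp 2 fun i => (starRingEnd ℂ) (b z i) • kernelVec z, G⟫_ℂ =
        ∑ i, b z i * G i z := by
    intro z G
    simp [PiLp.inner_apply, inner_smul_left, apply_eq_inner]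
  refine ⟨fun h z => ext_inner_right ℂ fun G => ?_, fun h G z => ?_⟩
  · rw [ContinuousLinearMap.adjoint_inner_left, ← apply_eq_inner, h G z, hinner]
  · rw [apply_eq_inner, ← ContinuousLinearMap.adjoint_inner_left, h, hinner]

theorem exists_isRowMultiplicationOp {Q : DruryArveson d →L[ℂ] DruryArveson d}
    (h : ∀ z w, ⟪b w, b z⟫_ℂ * ⟪kernelVec z, kernelVec w⟫_ℂ = ⟪kernelVec z, Q (kernelVec w)⟫_ℂ) :
    ∃ M : PiLp 2 (fun _ : Fin N => DruryArveson d) →L[ℂ] DruryArveson d,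
      IsRowMultiplicationOp b M ∧ M ∘L ContinuousLinearMap.adjoint M = Q := by
  let v : UnitBall d → PiLp 2 (fun _ : Fin N => DruryArveson d) := fun z =>
    WithLp.toLp 2 fun i => (starRingEnd ℂ) (b z i) • kernelVec z
  have hv : ∀ z w, ⟪v z, v w⟫_ℂ = ⟪kernelVec z, Q (kernelVec w)⟫_ℂ := by
    intro z w
    rw [← h, inner_eq_sum_conj_mul, Finset.sum_mul, PiLp.inner_apply]
    refine Finset.sum_congr rfl fun i _ => ?_
    simp only [v, inner_smul_left, inner_smul_right, Complex.conj_conj]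
    ring
  obtain ⟨T, hT, hTQ⟩ := exists_adjoint_comp_self_eq dense_span_range_kernelVec hv
  refine ⟨ContinuousLinearMap.adjoint T, isRowMultiplicationOp_iff.2 fun z => ?_, ?_⟩
  · rw [ContinuousLinearMap.adjoint_adjoint, hT]
  · rwa [ContinuousLinearMap.adjoint_adjoint]

end RowMultiplier

section KernelSpan

variable {d : ℕ}

/-- The span of the kernel functions of the points of `s`, disregarding multiplicities. -/
def kernelSpan (s : Multiset (UnitBall d)) : Submodule ℂ (DruryArveson d) :=
  Submodule.span ℂ (kernelVec '' {x | x ∈ s})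

instance (s : Multiset (UnitBall d)) : FiniteDimensional ℂ (kernelSpan s) :=
  FiniteDimensional.span_of_finite ℂ ((Multiset.finite_toSet s).image _)

/-- The orthogonal projection onto the span of the kernel functions of the points of `s`. -/
def kernelProj (s : Multiset (UnitBall d)) : DruryArveson d →L[ℂ] DruryArveson d :=
  (kernelSpan s).starProjection

/-- The component of the kernel function of `z` orthogonal to the kernel functions of the points
of `s`. -/
def kernelResidual (s : Multiset (UnitBall d)) (z : UnitBall d) : DruryArveson d :=
  (kernelSpan s)ᗮ.starProjection (kernelVec z)

theorem kernelVec_mem_kernelSpan {s : Multiset (UnitBall d)} {x : UnitBall d} (hx : x ∈ s) :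
    kernelVec x ∈ kernelSpan s :=
  Submodule.subset_span ⟨x, hx, rfl⟩

theorem kernelSpan_zero : kernelSpan (0 : Multiset (UnitBall d)) = ⊥ := by
  simp [kernelSpan]

theorem kernelSpan_cons (a : UnitBall d) (s : Multiset (UnitBall d)) :
    kernelSpan (a ::ₘ s) = kernelSpan s ⊔ Submodule.span ℂ {kernelVec a} := by
  have hset : {x | x ∈ a ::ₘ s} = insert a {x | x ∈ s} := by
    ext x
    simp
  rw [kernelSpan, hset, Set.image_insert_eq, Submodule.span_insert, sup_comm, kernelSpan]

theorem range_kernelProj (s : Multiset (UnitBall d)) :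
    (kernelProj s : DruryArveson d →ₗ[ℂ] DruryArveson d).range = kernelSpan s :=
  Submodule.range_starProjection _

theorem kernelProj_zero : kernelProj (0 : Multiset (UnitBall d)) = 0 := by
  simp only [kernelProj, kernelSpan_zero, Submodule.starProjection_bot]

theorem kernelProj_cons (a : UnitBall d) (s : Multiset (UnitBall d)) :
    kernelProj (a ::ₘ s) =
      kernelProj s + (Submodule.span ℂ {kernelResidual s a}).starProjection := by
  simp only [kernelProj, kernelSpan_cons]
  exact starProjection_sup_span_singleton _ _

theorem kernelResidual_eq_sub (s : Multiset (UnitBall d)) (z : UnitBall d) :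
    kernelResidual s z = kernelVec z - kernelProj s (kernelVec z) :=
  Submodule.starProjection_orthogonal_val _

theorem kernelResidual_zero (z : UnitBall d) :
    kernelResidual (0 : Multiset (UnitBall d)) z = kernelVec z := by
  rw [kernelResidual_eq_sub, kernelProj_zero, zero_apply, sub_zero]

theorem inner_kernelVec_kernelResidual (s : Multiset (UnitBall d)) (z w : UnitBall d) :
    ⟪kernelVec z, kernelResidual s w⟫_ℂ = ⟪kernelResidual s z, kernelResidual s w⟫_ℂ :=
  (inner_starProjection_starProjection _ _ _).symm

theorem inner_kernelResidual_cons (a : UnitBall d) (s : Multiset (UnitBall d)) (z w : UnitBall d) :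
    ⟪kernelResidual (a ::ₘ s) z, kernelResidual (a ::ₘ s) w⟫_ℂ =
      ⟪kernelResidual s z, kernelResidual s w⟫_ℂ -
        ⟪kernelResidual s z, kernelResidual s a⟫_ℂ * ⟪kernelResidual s a, kernelResidual s w⟫_ℂ /
          ⟪kernelResidual s a, kernelResidual s a⟫_ℂ := by
  simp only [kernelResidual, kernelSpan_cons]
  exact inner_starProjection_orthogonal_sup_span_singleton _ _ _ _

end KernelSpan

theorem inner_vecMul_of_mem_unitaryGroup {ι 𝕜 : Type*} [Fintype ι] [DecidableEq ι] [RCLike 𝕜]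
    {U : Matrix ι ι 𝕜} (hU : U ∈ Matrix.unitaryGroup ι 𝕜) (v w : EuclideanSpace 𝕜 ι) :
    ⟪WithLp.toLp 2 (Matrix.vecMul v.ofLp U), WithLp.toLp 2 (Matrix.vecMul w.ofLp U)⟫_𝕜 =
      ⟪v, w⟫_𝕜 := by
  rw [EuclideanSpace.inner_eq_star_dotProduct, Matrix.star_vecMul, Matrix.dotProduct_mulVec,
    Matrix.vecMul_vecMul, ← Matrix.star_eq_conjTranspose, Matrix.mem_unitaryGroup_iff.1 hU,
    Matrix.vecMul_one, EuclideanSpace.inner_eq_star_dotProduct]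

theorem exists_mem_unitaryGroup_forall_apply_eq {ι 𝕜 : Type*} [Fintype ι] [DecidableEq ι]
    [RCLike 𝕜] (j : ι) {v : EuclideanSpace 𝕜 ι} (hv : ‖v‖ = 1) :
    ∃ U ∈ Matrix.unitaryGroup ι 𝕜, ∀ i, U i j = v i := by
  obtain ⟨B, hB⟩ := Orthonormal.exists_orthonormalBasis_extension_of_card_eq (𝕜 := 𝕜)
    (E := EuclideanSpace 𝕜 ι) (ι := ι) (by simp) (v := fun _ => v) (s := {j})
    ⟨fun _ => hv, fun i j hij => absurd (Subsingleton.elim i j) hij⟩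
  refine ⟨(EuclideanSpace.basisFun ι 𝕜).toBasis.toMatrix B,
    OrthonormalBasis.toMatrix_orthonormalBasis_mem_unitary _ _, fun i => ?_⟩
  rw [Module.Basis.toMatrix_apply, hB j rfl]
  simp

section BlaschkeRow

variable {d : ℕ}

theorem inner_blaschkeStep {k : ℕ} (b : UnitBall d → EuclideanSpace ℂ (Fin (k + 1)))
    {U : Matrix (Fin (k + 1)) (Fin (k + 1)) ℂ} (hU : U ∈ Matrix.unitaryGroup (Fin (k + 1)) ℂ)
    (lam w z : UnitBall d) :
    ⟪blaschkeStep b U lam w, blaschkeStep b U lam z⟫_ℂ = ⟪b w, b z⟫_ℂ -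
      (starRingEnd ℂ) (Matrix.vecMul (b w).ofLp U 0) * Matrix.vecMul (b z).ofLp U 0 *
        (1 - ⟪ballInvolution (lam : EuclideanSpace ℂ (Fin d)) w,
          ballInvolution (lam : EuclideanSpace ℂ (Fin d)) z⟫_ℂ) := by
  rw [← inner_vecMul_of_mem_unitaryGroup hU]
  simp only [inner_eq_sum_conj_mul]
  rw [Fin.sum_univ_succ, Fin.sum_univ_add, mul_sub, Finset.mul_sum]
  simp only [blaschkeStep, Fin.append_left, Fin.append_right, map_mul, mul_mul_mul_comm]
  ring

theorem one_sub_inner_ballInvolution_mul_inner_kernelVec (lam z w : UnitBall d) :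
    (1 - ⟪ballInvolution (lam : EuclideanSpace ℂ (Fin d)) w,
        ballInvolution (lam : EuclideanSpace ℂ (Fin d)) z⟫_ℂ) * ⟪kernelVec z, kernelVec w⟫_ℂ =
      ⟪kernelVec z, kernelVec lam⟫_ℂ * ⟪kernelVec lam, kernelVec w⟫_ℂ /
        ⟪kernelVec lam, kernelVec lam⟫_ℂ := by
  rw [one_sub_inner_ballInvolution]
  simp only [inner_kernelVec]
  have hz := one_sub_inner_unitBall_ne_zero lam z
  have hw := one_sub_inner_unitBall_ne_zero w lam
  have hzw := one_sub_inner_unitBall_ne_zero w z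
  have hlam := one_sub_inner_unitBall_ne_zero lam lam
  field_simp

theorem vecMul_apply_of_column {k : ℕ} {U : Matrix (Fin k) (Fin k) ℂ} {j : Fin k}
    {u : EuclideanSpace ℂ (Fin k)} (hU : ∀ i, U i j = (starRingEnd ℂ) (u i) / (‖u‖ : ℂ))
    (v : EuclideanSpace ℂ (Fin k)) : Matrix.vecMul v.ofLp U j = ⟪u, v⟫_ℂ / ‖u‖ := by
  rw [inner_eq_sum_conj_mul, Finset.sum_div, Matrix.vecMul, dotProduct]
  refine Finset.sum_congr rfl fun i _ => ?_
  rw [hU, mul_div_assoc', mul_comm]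

theorem ne_zero_of_column {k : ℕ} {U : Matrix (Fin k) (Fin k) ℂ}
    (hUnit : U ∈ Matrix.unitaryGroup (Fin k) ℂ) {j : Fin k} {u : EuclideanSpace ℂ (Fin k)}
    (hU : ∀ i, U i j = (starRingEnd ℂ) (u i) / (‖u‖ : ℂ)) : u ≠ 0 := by
  rintro rfl
  have hdiag := congrFun (congrFun (Matrix.mem_unitaryGroup_iff'.1 hUnit) j) j
  simp [Matrix.mul_apply, hU] at hdiag

theorem IsBlaschkeRow.inner_mul_inner_kernelVec {l : List (UnitBall d)} {N : ℕ}
    {b : UnitBall d → EuclideanSpace ℂ (Fin N)} (h : IsBlaschkeRow l N b) (z w : UnitBall d) :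
    ⟪b w, b z⟫_ℂ * ⟪kernelVec z, kernelVec w⟫_ℂ =
      ⟪kernelResidual (l : Multiset (UnitBall d)) z, kernelResidual l w⟫_ℂ := by
  induction h generalizing z w with
  | single lam =>
    have hker := one_sub_inner_ballInvolution_mul_inner_kernelVec lam z w
    rw [← Multiset.cons_coe, Multiset.coe_nil, inner_kernelResidual_cons]
    simp only [kernelResidual_zero]
    linear_combination -hker
  | @step l k b lam U _ hU hU0 ih =>
    have hlist : ((l ++ [lam] : List (UnitBall d)) : Multiset (UnitBall d)) = lam ::ₘ l :=
      Multiset.coe_eq_coe.2 (List.perm_append_singleton _ _)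
    have hnorm : (‖b lam‖ : ℂ) ≠ 0 := by simpa using ne_zero_of_column hU hU0
    have hself : ⟪b lam, b lam⟫_ℂ = (‖b lam‖ : ℂ) ^ 2 := inner_self_eq_norm_sq_to_K _
    have hkernel : ⟪kernelVec lam, kernelVec lam⟫_ℂ ≠ 0 :=
      inner_self_ne_zero.2 (kernelVec_ne_zero lam)
    rw [hlist, inner_kernelResidual_cons, inner_blaschkeStep b hU, vecMul_apply_of_column hU0,
      vecMul_apply_of_column hU0, sub_mul, mul_assoc,
      one_sub_inner_ballInvolution_mul_inner_kernelVec, ← ih, ← ih, ← ih, ← ih, hself, map_div₀,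
      inner_conj_symm, Complex.conj_ofReal]
    field_simp

theorem IsBlaschkeRow.exists_isRowMultiplicationOp {l : List (UnitBall d)} {N : ℕ}
    {b : UnitBall d → EuclideanSpace ℂ (Fin N)} (h : IsBlaschkeRow l N b) :
    ∃ M : PiLp 2 (fun _ : Fin N => DruryArveson d) →L[ℂ] DruryArveson d,
      IsRowMultiplicationOp b M ∧ M ∘L ContinuousLinearMap.adjoint M =
        (kernelSpan (l : Multiset (UnitBall d)))ᗮ.starProjection :=
  _root_.exists_isRowMultiplicationOp fun z w => by
    rw [h.inner_mul_inner_kernelVec, ← inner_kernelVec_kernelResidual, kernelResidual]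

end BlaschkeRow

/-! ### Multipliers and independence of kernel functions -/

section Multiplier

variable {d : ℕ}

theorem isMultiplicationOp_mulOp {f : UnitBall d → ℂ} (h : f ∈ multiplierAlgebra d) :
    IsMultiplicationOp f (mulOp f) := by
  have hop : ∃ T, IsMultiplicationOp f T := h
  rw [mulOp, dif_pos hop]
  exact hop.choose_spec

theorem IsMultiplicationOp.adjoint_kernelVec {f : UnitBall d → ℂ}
    {T : DruryArveson d →L[ℂ] DruryArveson d} (h : IsMultiplicationOp f T) (z : UnitBall d) :
    ContinuousLinearMap.adjoint T (kernelVec z) = (starRingEnd ℂ) (f z) • kernelVec z := by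
  refine ext_inner_right ℂ fun g => ?_
  rw [ContinuousLinearMap.adjoint_inner_left, ← apply_eq_inner, h g z, inner_smul_left,
    Complex.conj_conj, apply_eq_inner]

/- Since `φ_0 z = -z`, the row of coordinate functions is a Blaschke row up to sign. -/
theorem coord_mem_multiplierAlgebra (j : Fin d) :
    (fun z : UnitBall d => (z : EuclideanSpace ℂ (Fin d)) j) ∈ multiplierAlgebra d := by
  obtain ⟨M, hM, -⟩ :=
    (IsBlaschkeRow.single (⟨0, by simp⟩ : UnitBall d)).exists_isRowMultiplicationOp
  let ι : DruryArveson d →L[ℂ] PiLp 2 (fun _ : Fin d => DruryArveson d) :=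
    (PiLp.continuousLinearEquiv 2 ℂ (fun _ : Fin d => DruryArveson d)).symm.toContinuousLinearMap ∘L
      ContinuousLinearMap.single ℂ (fun _ : Fin d => DruryArveson d) j
  have hι : ∀ g i, (ι g) i = Pi.single (M := fun _ => DruryArveson d) j g i := fun _ _ => rfl
  refine ⟨-(M ∘L ι), fun g z => ?_⟩
  rw [neg_apply, RKHS.coe_neg (𝕜 := ℂ), Pi.neg_apply, ContinuousLinearMap.comp_apply, hM,
    Finset.sum_eq_single j]
  · rw [hι, Pi.single_eq_same]
    simp [ballInvolution, lineProj]
  · intro i _ hi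
    rw [hι, Pi.single_eq_of_ne hi, RKHS.coe_zero (𝕜 := ℂ), Pi.zero_apply, mul_zero]
  · simp

theorem isMultiplicationOp_coordShift (j : Fin d) :
    IsMultiplicationOp (fun z : UnitBall d => (z : EuclideanSpace ℂ (Fin d)) j) (coordShift j) :=
  isMultiplicationOp_mulOp (coord_mem_multiplierAlgebra j)

theorem adjoint_coordShift_kernelVec (j : Fin d) (z : UnitBall d) :
    ContinuousLinearMap.adjoint (coordShift j) (kernelVec z) =
      (starRingEnd ℂ) ((z : EuclideanSpace ℂ (Fin d)) j) • kernelVec z :=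
  (isMultiplicationOp_coordShift j).adjoint_kernelVec z

/-- The operator of multiplication by the affine function `z ↦ ⟨z - y, u⟩`, which vanishes
at `y`. -/
def affineMul (u y : EuclideanSpace ℂ (Fin d)) : DruryArveson d →L[ℂ] DruryArveson d :=
  ∑ j, (starRingEnd ℂ) (u j) • (coordShift j - y j • ContinuousLinearMap.id ℂ (DruryArveson d))

theorem isMultiplicationOp_affineMul (u y : EuclideanSpace ℂ (Fin d)) :
    IsMultiplicationOp (fun z : UnitBall d => ⟪u, z - y⟫_ℂ) (affineMul u y) := by
  intro g z
  have hshift : ∀ j, ⟪kernelVec z, coordShift j g⟫_ℂ =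
      (z : EuclideanSpace ℂ (Fin d)) j * ⟪kernelVec z, g⟫_ℂ :=
    fun j => isMultiplicationOp_coordShift j g z
  beta_reduce
  rw [apply_eq_inner, affineMul, sum_apply, inner_sum, inner_eq_sum_conj_mul, Finset.sum_mul]
  refine Finset.sum_congr rfl fun j _ => ?_
  simp only [smul_apply, sub_apply, ContinuousLinearMap.id_apply, inner_smul_right,
    inner_sub_right, hshift, PiLp.sub_apply, apply_eq_inner]
  ring

theorem norm_affineMul_le (u y : EuclideanSpace ℂ (Fin d)) :
    ‖affineMul u y‖ ≤ ∑ j : Fin d, ‖u‖ * (‖coordShift j‖ + ‖y‖) := by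
  refine (norm_sum_le _ _).trans (Finset.sum_le_sum fun j _ => ?_)
  rw [norm_smul, RCLike.norm_conj]
  gcongr
  · exact PiLp.norm_apply_le u j
  · refine (norm_sub_le _ _).trans (add_le_add_right ?_ _)
    rw [norm_smul]
    exact (mul_le_of_le_one_right (norm_nonneg _) ContinuousLinearMap.norm_id_le).trans
      (PiLp.norm_apply_le y j)

theorem exists_norm_affineMul_le (d : ℕ) :
    ∃ C, 0 ≤ C ∧ ∀ x y : UnitBall d, ‖affineMul (x - y : EuclideanSpace ℂ (Fin d)) y‖ ≤ C := by
  refine ⟨∑ j : Fin d, 2 * (‖coordShift j‖ + 1), by positivity, fun x y => ?_⟩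
  have hx := norm_coe_unitBall_lt_one x
  have hy := norm_coe_unitBall_lt_one y
  refine (norm_affineMul_le _ _).trans (Finset.sum_le_sum fun j _ => ?_)
  gcongr
  exact (norm_sub_le _ _).trans (by linarith)

end Multiplier

section Interpolation

variable {d : ℕ}

theorem exists_norm_le_forall_apply_eq_zero (d n : ℕ) :
    ∃ C, 0 ≤ C ∧ ∀ (x : UnitBall d) (s : Multiset (UnitBall d)), Multiset.card s = n →
      ∃ f : DruryArveson d, ‖f‖ ≤ C ∧ (∀ y ∈ s, f y = 0) ∧
        f x = ((s.map fun y => dist x y ^ 2).prod : ℝ) := by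
  obtain ⟨C, hC, hnorm⟩ := exists_norm_affineMul_le d
  let o : UnitBall d := ⟨0, by simp⟩
  refine ⟨C ^ n * ‖kernelVec o‖, by positivity, fun x s => ?_⟩
  induction s using Multiset.induction generalizing n with
  | empty =>
    rintro rfl
    refine ⟨kernelVec o, by simp, by simp, ?_⟩
    rw [apply_eq_inner, inner_kernelVec]
    simp [o]
  | cons y s ih =>
    rintro rfl
    obtain ⟨f, hf, hzero, hx⟩ := ih (Multiset.card s) rfl
    have hmul : ∀ w : UnitBall d, affineMul (x - y : EuclideanSpace ℂ (Fin d)) y f w =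
        ⟪(x - y : EuclideanSpace ℂ (Fin d)), w - y⟫_ℂ * f w := isMultiplicationOp_affineMul _ _ f
    refine ⟨affineMul (x - y : EuclideanSpace ℂ (Fin d)) y f, ?_, fun w hw => ?_, ?_⟩
    · rw [Multiset.card_cons, pow_succ', mul_assoc]
      exact (ContinuousLinearMap.le_opNorm _ f).trans
        (mul_le_mul (hnorm x y) hf (norm_nonneg _) hC)
    · rw [hmul]
      rcases Multiset.mem_cons.1 hw with rfl | hw
      · rw [sub_self, inner_zero_right, zero_mul]
      · rw [hzero w hw, mul_zero]
    · rw [hmul, hx, inner_self_eq_norm_sq_to_K, Multiset.map_cons, Multiset.prod_cons,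
        Subtype.dist_eq, dist_eq_norm]
      simp

theorem mem_orthogonal_kernelSpan_iff {s : Multiset (UnitBall d)} {f : DruryArveson d} :
    f ∈ (kernelSpan s)ᗮ ↔ ∀ y ∈ s, f y = 0 := by
  rw [Submodule.mem_orthogonal]
  refine ⟨fun h y hy => h _ (kernelVec_mem_kernelSpan hy), fun h v hv => ?_⟩
  induction hv using Submodule.span_induction with
  | mem v hv =>
    obtain ⟨y, hy, rfl⟩ := hv
    exact h y hy
  | zero => exact inner_zero_left _
  | add u v _ _ hu hv => rw [inner_add_left, hu, hv, add_zero]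
  | smul c v _ hv => rw [inner_smul_left, hv, mul_zero]

theorem inner_kernelResidual_of_mem_orthogonal {s : Multiset (UnitBall d)} {f : DruryArveson d}
    (hf : f ∈ (kernelSpan s)ᗮ) (x : UnitBall d) : ⟪kernelResidual s x, f⟫_ℂ = f x := by
  rw [kernelResidual, Submodule.inner_starProjection_left_eq_right,
    Submodule.starProjection_eq_self_iff.2 hf, apply_eq_inner]

theorem exists_prod_dist_sq_le_mul_norm_kernelResidual (d n : ℕ) :
    ∃ C, 0 ≤ C ∧ ∀ (x : UnitBall d) (s : Multiset (UnitBall d)), Multiset.card s = n →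
      (s.map fun y => dist x y ^ 2).prod ≤ C * ‖kernelResidual s x‖ := by
  obtain ⟨C, hC, hinterp⟩ := exists_norm_le_forall_apply_eq_zero d n
  refine ⟨C, hC, fun x s hs => ?_⟩
  obtain ⟨f, hf, hzero, hx⟩ := hinterp x s hs
  calc (s.map fun y => dist x y ^ 2).prod ≤ ‖f x‖ := by
        rw [hx, Complex.norm_real]
        exact Real.le_norm_self _
    _ = ‖⟪kernelResidual s x, f⟫_ℂ‖ := by
        rw [inner_kernelResidual_of_mem_orthogonal (mem_orthogonal_kernelSpan_iff.2 hzero)]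
    _ ≤ ‖kernelResidual s x‖ * ‖f‖ := norm_inner_le_norm _ _
    _ ≤ C * ‖kernelResidual s x‖ := by
        rw [mul_comm]
        gcongr

theorem kernelResidual_ne_zero {s : Multiset (UnitBall d)} {x : UnitBall d} (hx : x ∉ s) :
    kernelResidual s x ≠ 0 := by
  intro hzero
  obtain ⟨C, -, hC⟩ := exists_prod_dist_sq_le_mul_norm_kernelResidual d (Multiset.card s)
  have hprod := hC x s rfl
  rw [hzero, norm_zero, mul_zero] at hprod
  refine hprod.not_gt (Multiset.prod_pos ?_)
  simp only [Multiset.mem_map, forall_exists_index, and_imp, forall_apply_eq_imp_iff₂]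
  exact fun y hy => pow_pos (dist_pos.2 (ne_of_mem_of_not_mem hy hx).symm) 2

theorem kernelVec_mem_kernelSpan_iff {s : Multiset (UnitBall d)} {x : UnitBall d} :
    kernelVec x ∈ kernelSpan s ↔ x ∈ s := by
  refine ⟨fun h => ?_, kernelVec_mem_kernelSpan⟩
  by_contra hx
  refine kernelResidual_ne_zero hx ?_
  rw [kernelResidual_eq_sub, kernelProj, Submodule.starProjection_eq_self_iff.2 h, sub_self]

theorem finrank_kernelSpan {s : Multiset (UnitBall d)} (hs : s.Nodup) :
    Module.finrank ℂ (kernelSpan s) = Multiset.card s := by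
  induction s using Multiset.induction with
  | empty => rw [kernelSpan_zero, finrank_bot, Multiset.card_zero]
  | cons a s ih =>
    obtain ⟨ha, hs⟩ := Multiset.nodup_cons.1 hs
    have hdisj : Disjoint (kernelSpan s) (Submodule.span ℂ {kernelVec a}) :=
      (Submodule.disjoint_span_singleton' (kernelVec_ne_zero a)).2
        (mt kernelVec_mem_kernelSpan_iff.1 ha)
    have hdim := Submodule.finrank_sup_add_finrank_inf_eq (kernelSpan s)
      (Submodule.span ℂ {kernelVec a})
    rwa [hdisj.eq_bot, finrank_bot, add_zero, finrank_span_singleton (kernelVec_ne_zero a),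
      ← kernelSpan_cons, ih hs, ← Multiset.card_cons a s] at hdim

theorem IsBlaschkeRow.apply_ne_zero {l : List (UnitBall d)} {N : ℕ}
    {b : UnitBall d → EuclideanSpace ℂ (Fin N)} (hb : IsBlaschkeRow l N b) {a : UnitBall d}
    (ha : a ∉ l) : b a ≠ 0 := by
  intro hzero
  have hinner := hb.inner_mul_inner_kernelVec a a
  rw [hzero, inner_zero_left, zero_mul] at hinner
  exact kernelResidual_ne_zero (mt Multiset.mem_coe.1 ha) (inner_self_eq_zero.1 hinner.symm)

theorem IsBlaschkeRow.exists_step {l : List (UnitBall d)} {N k : ℕ}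
    {b : UnitBall d → EuclideanSpace ℂ (Fin N)} (hb : IsBlaschkeRow l N b) (hN : N = k + 1)
    {a : UnitBall d} (ha : a ∉ l) : ∃ b', IsBlaschkeRow (l ++ [a]) (d + k) b' := by
  subst hN
  have hnorm : (‖b a‖ : ℂ) ≠ 0 := by simpa using hb.apply_ne_zero ha
  have hunit : ‖WithLp.toLp 2 fun i => (starRingEnd ℂ) (b a i) / (‖b a‖ : ℂ)‖ = 1 := by
    rw [← pow_left_inj₀ (norm_nonneg _) zero_le_one two_ne_zero, EuclideanSpace.norm_sq_eq]
    simp only [norm_div, RCLike.norm_conj, div_pow, Complex.norm_real, norm_norm]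
    rw [← Finset.sum_div, ← EuclideanSpace.norm_sq_eq, one_pow,
      div_self (pow_ne_zero 2 (by exact_mod_cast hnorm))]
  obtain ⟨U, hU, hU0⟩ := exists_mem_unitaryGroup_forall_apply_eq 0 hunit
  exact ⟨_, IsBlaschkeRow.step a U hb hU hU0⟩

theorem exists_isBlaschkeRow (hd : 0 < d) {l : List (UnitBall d)} (hl : l.Nodup) (hne : l ≠ []) :
    ∃ b, IsBlaschkeRow l ((l.length - 1) * (d - 1) + d) b := by
  induction l using List.reverseRecOn with
  | nil => exact absurd rfl hne
  | append_singleton l a ih =>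
    rcases l with _ | ⟨x, l⟩
    · have hsize : ([] ++ [a] : List (UnitBall d)).length - 1 = 0 := rfl
      rw [hsize, zero_mul, zero_add]
      exact ⟨_, IsBlaschkeRow.single a⟩
    · obtain ⟨hl, -, hdisj⟩ := List.nodup_append.1 hl
      obtain ⟨b, hb⟩ := ih hl (List.cons_ne_nil x l)
      have hsize : (x :: l ++ [a]).length - 1 = l.length + 1 := by simp
      rw [hsize, add_one_mul, add_comm]
      exact hb.exists_step (by rw [List.length_cons, Nat.add_sub_cancel]; omega)
        fun ha => hdisj a ha a (List.mem_singleton_self a) rfl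

end Interpolation

/-! ### Coinvariant subspaces and their joint spectra -/

section Eigenvector

variable {d : ℕ}

/-- The weight `(|α|! / α!)^{1/2}`, so that `normMonomial α z = monomialWeight α * z^α`. -/
def monomialWeight (α : Fin d → ℕ) : ℝ :=
  Real.sqrt (((∑ j, α j).factorial : ℝ) / ∏ j, ((α j).factorial : ℝ))

theorem ofReal_monomialWeight_ne_zero (α : Fin d → ℕ) : (monomialWeight α : ℂ) ≠ 0 :=
  Complex.ofReal_ne_zero.2 (Real.sqrt_pos.2 (by positivity)).ne'

open Classical in
/-- The monomial `z^α` as an element of the Drury-Arveson space. -/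
def monomialVec (α : Fin d → ℕ) : DruryArveson d :=
  (lp.single 2 α ((monomialWeight α : ℂ)⁻¹) : lp (fun _ : Fin d → ℕ => ℂ) 2)

theorem inner_monomialVec (α : Fin d → ℕ) (f : DruryArveson d) :
    ⟪monomialVec α, f⟫_ℂ = (monomialWeight α : ℂ)⁻¹ * coeff f α := by
  classical
  refine (lp.inner_single_left (𝕜 := ℂ) (G := fun _ : Fin d → ℕ => ℂ) α
    ((monomialWeight α : ℂ)⁻¹) f).trans ?_
  rw [RCLike.inner_apply, map_inv₀, Complex.conj_ofReal, mul_comm, coeff]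

theorem coeff_eq_monomialWeight_mul_inner (f : DruryArveson d) (α : Fin d → ℕ) :
    coeff f α = monomialWeight α * ⟪monomialVec α, f⟫_ℂ := by
  rw [inner_monomialVec, mul_inv_cancel_left₀ (ofReal_monomialWeight_ne_zero α)]

theorem monomialVec_apply (α : Fin d → ℕ) (z : UnitBall d) :
    monomialVec α z = ∏ j, (z : EuclideanSpace ℂ (Fin d)) j ^ α j := by
  have hcoeff : coeff (kernelVec z) α = (starRingEnd ℂ) (normMonomial α z) := rfl
  rw [apply_eq_inner, ← inner_conj_symm, inner_monomialVec, hcoeff, map_mul, Complex.conj_conj,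
    map_inv₀, Complex.conj_ofReal, normMonomial, ← monomialWeight,
    inv_mul_cancel_left₀ (ofReal_monomialWeight_ne_zero α)]

theorem coordShift_monomialVec (j : Fin d) (α : Fin d → ℕ) :
    coordShift j (monomialVec α) = monomialVec (α + Pi.single j 1) := by
  refine RKHS.ext (𝕜 := ℂ) (X := UnitBall d) (V := ℂ) fun z => ?_
  rw [isMultiplicationOp_coordShift j, monomialVec_apply, monomialVec_apply, mul_comm]
  simpa only [List.prod_ofFn] using (prod_ofFn_pow_add_single
    (N := fun i => (z : EuclideanSpace ℂ (Fin d)) i) (fun _ _ => Commute.all _ _) α j).symm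

theorem inner_monomialVec_of_eigenvector {v : DruryArveson d} {c : Fin d → ℂ}
    (hv : ∀ j, ContinuousLinearMap.adjoint (coordShift j) v = c j • v) (α : Fin d → ℕ) :
    ⟪monomialVec α, v⟫_ℂ = (∏ j, c j ^ α j) * ⟪monomialVec 0, v⟫_ℂ := by
  generalize hm : ∑ j, α j = m
  induction m generalizing α with
  | zero =>
    have hα : α = 0 := funext fun j => Finset.sum_eq_zero_iff.1 hm j (Finset.mem_univ j)
    simp [hα]
  | succ m ih =>
    obtain ⟨β, i, rfl, hβ⟩ := exists_eq_add_single hm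
    have hprod : ∏ j, c j ^ (β + Pi.single i 1 : Fin d → ℕ) j = (∏ j, c j ^ β j) * c i := by
      simpa only [List.prod_ofFn] using
        prod_ofFn_pow_add_single (N := c) (fun _ _ => Commute.all _ _) β i
    rw [← coordShift_monomialVec, ← ContinuousLinearMap.adjoint_inner_right, hv,
      inner_smul_right, ih β hβ, hprod]
    ring

theorem mem_ball_of_summable_norm_normMonomial_sq {lam : EuclideanSpace ℂ (Fin d)}
    (h : Summable fun α => ‖normMonomial α lam‖ ^ 2) : lam ∈ Metric.ball 0 1 := by
  have hgeom : Summable fun m : ℕ => (‖lam‖ ^ 2) ^ m := by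
    refine (hasSum_sum_piAntidiag h.hasSum).summable.congr fun m => ?_
    rw [EuclideanSpace.norm_sq_eq, Finset.sum_pow_eq_sum_piAntidiag]
    exact Finset.sum_congr rfl fun α _ => norm_normMonomial_sq α lam
  rw [summable_geometric_iff_norm_lt_one, norm_pow, norm_norm] at hgeom
  exact mem_ball_zero_iff.2 ((pow_lt_one_iff_of_nonneg (norm_nonneg lam) two_ne_zero).1 hgeom)

theorem exists_eq_smul_kernelVec_of_eigenvector {v : DruryArveson d} (hv0 : v ≠ 0)
    {lam : EuclideanSpace ℂ (Fin d)}
    (hv : ∀ j, ContinuousLinearMap.adjoint (coordShift j) v = (starRingEnd ℂ) (lam j) • v) :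
    ∃ (hlam : lam ∈ Metric.ball 0 1) (c : ℂ), c ≠ 0 ∧ v = c • kernelVec ⟨lam, hlam⟩ := by
  set c := ⟪monomialVec 0, v⟫_ℂ
  have hcoeff : ∀ α, coeff v α = c * (starRingEnd ℂ) (normMonomial α lam) := by
    intro α
    rw [coeff_eq_monomialWeight_mul_inner, inner_monomialVec_of_eigenvector hv, normMonomial,
      ← monomialWeight, map_mul, map_prod, Complex.conj_ofReal]
    simp only [map_pow]
    ring
  have hc : c ≠ 0 := fun hc => hv0 <| lp.ext <| funext fun α =>
    (hcoeff α).trans (by rw [hc, zero_mul]; rfl)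
  have hsum : Summable fun α => ‖coeff v α‖ ^ 2 := by
    simpa [coeff] using
      (lp.memℓp (show lp (fun _ : Fin d → ℕ => ℂ) 2 from v)).summable (by norm_num)
  simp only [hcoeff, norm_mul, mul_pow, RCLike.norm_conj] at hsum
  have hlam : lam ∈ Metric.ball 0 1 := mem_ball_of_summable_norm_normMonomial_sq
    ((summable_mul_left_iff (pow_ne_zero 2 (norm_ne_zero_iff.2 hc))).1 hsum)
  exact ⟨hlam, c, hc, lp.ext (funext hcoeff)⟩

theorem coordShift_comp_coordShift_comm (i j : Fin d) :
    coordShift i ∘L coordShift j = coordShift j ∘L coordShift i := by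
  refine ContinuousLinearMap.ext fun f => RKHS.ext (𝕜 := ℂ) (X := UnitBall d) (V := ℂ) fun z => ?_
  simp only [ContinuousLinearMap.comp_apply, isMultiplicationOp_coordShift _ _ z]
  exact mul_left_comm _ _ _

end Eigenvector

section Compression

variable {d n : ℕ}

/-- The coinvariant subspace onto which a coinvariant projection projects. -/
abbrev coinvariantSubspace (P : coinvariantProj d n) : Submodule ℂ (DruryArveson d) :=
  (P.1 : DruryArveson d →ₗ[ℂ] DruryArveson d).range

instance (P : coinvariantProj d n) : FiniteDimensional ℂ (coinvariantSubspace P) :=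
  P.2.2.2.2.1

theorem finrank_coinvariantSubspace (P : coinvariantProj d n) :
    Module.finrank ℂ (coinvariantSubspace P) = n :=
  P.2.2.2.2.2

theorem starProjection_coinvariantSubspace (P : coinvariantProj d n) :
    (coinvariantSubspace P).starProjection = P.1 := by
  have hP : IsStarProjection P.1 := ⟨P.2.1, P.2.2.1⟩
  obtain ⟨_, h⟩ := isStarProjection_iff_eq_starProjection_range.1 hP
  exact h.symm

theorem inner_apply_of_mem_coinvariantSubspace (P : coinvariantProj d n) {v : DruryArveson d}
    (hv : v ∈ coinvariantSubspace P) (f : DruryArveson d) : ⟪v, P.1 f⟫_ℂ = ⟪v, f⟫_ℂ := by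
  rw [← starProjection_coinvariantSubspace P, ← Submodule.inner_starProjection_left_eq_right,
    Submodule.starProjection_eq_self_iff.2 hv]

theorem adjoint_mulOp_mem_coinvariantSubspace (P : coinvariantProj d n) {f : UnitBall d → ℂ}
    (hf : f ∈ multiplierAlgebra d) {v : DruryArveson d} (hv : v ∈ coinvariantSubspace P) :
    ContinuousLinearMap.adjoint (mulOp f) v ∈ coinvariantSubspace P := by
  obtain ⟨u, rfl⟩ := hv
  exact ⟨_, congrArg (fun T => T u) (P.2.2.2.1 f hf)⟩

theorem adjoint_coordShift_mem_coinvariantSubspace (P : coinvariantProj d n) (j : Fin d)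
    {v : DruryArveson d} (hv : v ∈ coinvariantSubspace P) :
    ContinuousLinearMap.adjoint (coordShift j) v ∈ coinvariantSubspace P :=
  adjoint_mulOp_mem_coinvariantSubspace P (coord_mem_multiplierAlgebra j) hv

theorem coe_adjoint_compressedShift (P : coinvariantProj d n) (j : Fin d)
    (v : coinvariantSubspace P) :
    (LinearMap.adjoint (compressedShift P.1 j) v : DruryArveson d) =
      ContinuousLinearMap.adjoint (coordShift j) (v : DruryArveson d) := by
  suffices h : LinearMap.adjoint (compressedShift P.1 j) v =
      ⟨_, adjoint_coordShift_mem_coinvariantSubspace P j v.2⟩ from congrArg Subtype.val h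
  refine ext_inner_right ℂ fun w => ?_
  calc ⟪LinearMap.adjoint (compressedShift P.1 j) v, w⟫_ℂ
      = ⟪(v : DruryArveson d), P.1 (coordShift j w)⟫_ℂ := LinearMap.adjoint_inner_left _ _ _
    _ = ⟪(v : DruryArveson d), coordShift j w⟫_ℂ :=
        inner_apply_of_mem_coinvariantSubspace P v.2 _
    _ = ⟪ContinuousLinearMap.adjoint (coordShift j) (v : DruryArveson d), w⟫_ℂ :=
        (ContinuousLinearMap.adjoint_inner_left _ _ _).symm

theorem commute_compressedShift (P : coinvariantProj d n) (i j : Fin d) :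
    Commute (compressedShift P.1 i) (compressedShift P.1 j) := by
  refine LinearMap.adjoint.injective (LinearMap.ext fun v => Subtype.ext ?_)
  have hcomm := congrArg (fun T => ContinuousLinearMap.adjoint T (v : DruryArveson d))
    (coordShift_comp_coordShift_comm i j)
  simpa only [Module.End.mul_eq_comp, LinearMap.adjoint_comp, LinearMap.comp_apply,
    coe_adjoint_compressedShift, ContinuousLinearMap.adjoint_comp,
    ContinuousLinearMap.comp_apply] using hcomm

theorem mem_jointSpectrum_compressedShift_iff (P : coinvariantProj d n)
    {lam : EuclideanSpace ℂ (Fin d)} :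
    lam ∈ jointSpectrum (compressedShift P.1) ↔
      ∃ hlam : lam ∈ Metric.ball 0 1, kernelVec ⟨lam, hlam⟩ ∈ coinvariantSubspace P := by
  simp only [mem_jointSpectrum_iff_adjoint (commute_compressedShift P), Subtype.ext_iff,
    coe_adjoint_compressedShift, Submodule.coe_smul]
  constructor
  · rintro ⟨v, hv0, hv⟩
    obtain ⟨hlam, c, hc, hvc⟩ :=
      exists_eq_smul_kernelVec_of_eigenvector (Submodule.coe_eq_zero.not.2 hv0) hv
    exact ⟨hlam, (Submodule.smul_mem_iff _ hc).1 (hvc ▸ v.2)⟩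
  · rintro ⟨hlam, hmem⟩
    exact ⟨⟨_, hmem⟩, fun h => kernelVec_ne_zero _ (congrArg Subtype.val h),
      fun j => adjoint_coordShift_kernelVec j ⟨lam, hlam⟩⟩

theorem isJointSpectrumWithMult_Psi (P : coinvariantProj d n) :
    IsJointSpectrumWithMult (compressedShift P.1) (Psi d n P) := by
  have hex : ∃ X : SymPolyball d n, IsJointSpectrumWithMult (compressedShift P.1) X :=
    exists_isJointSpectrumWithMult (commute_compressedShift P) (finrank_coinvariantSubspace P)
      fun _ hlam => ((mem_jointSpectrum_compressedShift_iff P).1 hlam).1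
  rw [Psi, dif_pos hex]
  exact hex.choose_spec

theorem mem_Psi_iff (P : coinvariantProj d n) {x : UnitBall d} :
    x ∈ (Psi d n P).1 ↔ kernelVec x ∈ coinvariantSubspace P := by
  classical
  have hspec : (x : EuclideanSpace ℂ (Fin d)) ∈ jointSpectrum (compressedShift P.1) ↔
      kernelVec x ∈ coinvariantSubspace P :=
    (mem_jointSpectrum_compressedShift_iff P).trans ⟨fun h => h.2, fun h => ⟨x.2, h⟩⟩
  have hcount := (isJointSpectrumWithMult_Psi P).2 x
  rw [← hspec, ← Multiset.count_ne_zero]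
  by_cases hx : (x : EuclideanSpace ℂ (Fin d)) ∈ jointSpectrum (compressedShift P.1)
  · have hne := (mem_jointSpectrum_iff_rootSubspace_ne_bot (commute_compressedShift P)).1 hx
    rw [if_pos hx] at hcount
    refine iff_of_true ?_ hx
    convert mt Submodule.finrank_eq_zero.1 hne using 1
  · rw [if_neg hx] at hcount
    exact iff_of_false (not_not_intro (by convert hcount)) hx

theorem kernelProj_mem_coinvariantProj {s : Multiset (UnitBall d)} (hs : s.Nodup)
    (hn : Multiset.card s = n) : kernelProj s ∈ coinvariantProj d n := by
  have hproj : IsStarProjection (kernelProj s) := isStarProjection_starProjection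
  refine ⟨hproj.isIdempotentElem, hproj.isSelfAdjoint, fun f hf => ?_, ?_, ?_⟩
  · have hinv : kernelSpan s ≤
        (kernelSpan s).comap (ContinuousLinearMap.adjoint (mulOp f)).toLinearMap := by
      refine Submodule.span_le.2 ?_
      rintro _ ⟨x, hx, rfl⟩
      rw [SetLike.mem_coe, Submodule.mem_comap, ContinuousLinearMap.coe_coe,
        (isMultiplicationOp_mulOp hf).adjoint_kernelVec]
      exact Submodule.smul_mem _ _ (kernelVec_mem_kernelSpan hx)
    exact ContinuousLinearMap.ext fun g => Submodule.starProjection_eq_self_iff.2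
      (hinv (Submodule.starProjection_apply_mem _ g))
  · rw [range_kernelProj]
    infer_instance
  · rw [range_kernelProj, finrank_kernelSpan hs, hn]

theorem Psi_kernelProj {s : Multiset (UnitBall d)} (hs : s.Nodup) (hn : Multiset.card s = n) :
    (Psi d n ⟨kernelProj s, kernelProj_mem_coinvariantProj hs hn⟩).1 = s := by
  refine (Multiset.eq_of_le_of_card_le ((Multiset.le_iff_subset hs).2 fun x hx => ?_) ?_).symm
  · rw [mem_Psi_iff, coinvariantSubspace, range_kernelProj]
    exact kernelVec_mem_kernelSpan hx
  · exact ((Psi d n _).2.trans hn.symm).le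

theorem kernelProj_Psi (P : coinvariantProj d n) (hP : (Psi d n P).1.Nodup) :
    kernelProj (Psi d n P).1 = P.1 := by
  have hle : kernelSpan (Psi d n P).1 ≤ coinvariantSubspace P := by
    refine Submodule.span_le.2 ?_
    rintro _ ⟨x, hx, rfl⟩
    exact (mem_Psi_iff P).1 hx
  have hspan : kernelSpan (Psi d n P).1 = coinvariantSubspace P :=
    Submodule.eq_of_le_of_finrank_eq hle <| by
      rw [finrank_kernelSpan hP, finrank_coinvariantSubspace]
      exact (Psi d n P).2
  rw [← starProjection_coinvariantSubspace, kernelProj]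
  congr!

end Compression

/-! ### The topology of the symmetrized polyball -/

section Pseudohyperbolic

open Filter Topology

variable {d : ℕ}

theorem one_sub_norm_sq_pos (x : UnitBall d) :
    0 < 1 - ‖(x : EuclideanSpace ℂ (Fin d))‖ ^ 2 := by
  have := norm_coe_unitBall_lt_one x
  nlinarith [norm_nonneg (x : EuclideanSpace ℂ (Fin d))]

theorem pseudohyperbolicDist_self (x : UnitBall d) : pseudohyperbolicDist x x = 0 := by
  have hne := one_sub_inner_unitBall_ne_zero x x
  have h := one_sub_inner_ballInvolution x x x
  rw [div_self (mul_ne_zero hne hne), sub_eq_self, inner_self_eq_zero] at h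
  rw [pseudohyperbolicDist, h, norm_zero]

theorem continuous_pseudohyperbolicDist (x : UnitBall d) :
    Continuous (pseudohyperbolicDist x) := by
  have hinv : Continuous fun z : UnitBall d =>
      (1 - ⟪(x : EuclideanSpace ℂ (Fin d)), z⟫_ℂ)⁻¹ :=
    Continuous.inv₀ (by fun_prop) (one_sub_inner_unitBall_ne_zero x)
  have hinvolution : Continuous fun z : UnitBall d =>
      ballInvolution (x : EuclideanSpace ℂ (Fin d)) z := by
    simp only [ballInvolution, lineProj]
    fun_prop
  exact hinvolution.norm

theorem one_sub_pseudohyperbolicDist_sq_mul (x z : UnitBall d) :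
    (1 - pseudohyperbolicDist x z ^ 2) *
        ‖1 - ⟪(x : EuclideanSpace ℂ (Fin d)), z⟫_ℂ‖ ^ 2 =
      (1 - ‖(x : EuclideanSpace ℂ (Fin d))‖ ^ 2) *
        (1 - ‖(z : EuclideanSpace ℂ (Fin d))‖ ^ 2) := by
  have h := one_sub_inner_ballInvolution x z z
  rw [eq_div_iff (mul_ne_zero (one_sub_inner_unitBall_ne_zero _ _)
    (one_sub_inner_unitBall_ne_zero _ _))] at h
  have hconj : (1 - ⟪(z : EuclideanSpace ℂ (Fin d)), x⟫_ℂ) *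
      (1 - ⟪(x : EuclideanSpace ℂ (Fin d)), z⟫_ℂ) =
        (‖1 - ⟪(x : EuclideanSpace ℂ (Fin d)), z⟫_ℂ‖ : ℂ) ^ 2 := by
    rw [← Complex.conj_mul', map_sub, map_one, inner_conj_symm]
  rw [hconj] at h
  simp only [inner_self_eq_norm_sq_to_K] at h
  refine Complex.ofReal_injective ?_
  push_cast
  exact h

theorem one_sub_norm_sq_mul_dist_sq_le (x z : UnitBall d) :
    (1 - ‖(x : EuclideanSpace ℂ (Fin d))‖ ^ 2) * dist x z ^ 2 ≤
      4 * pseudohyperbolicDist x z ^ 2 := by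
  set p := ⟪(x : EuclideanSpace ℂ (Fin d)), z⟫_ℂ
  have hone : ‖1 - p‖ ≤ 2 := by
    have h := norm_sub_le 1 p
    have hlt := norm_inner_unitBall_lt_one x z
    rw [norm_one] at h
    linarith
  have hdist : dist x z ^ 2 = ‖(x : EuclideanSpace ℂ (Fin d))‖ ^ 2 - 2 * p.re +
      ‖(z : EuclideanSpace ℂ (Fin d))‖ ^ 2 := by
    rw [Subtype.dist_eq, dist_eq_norm, @norm_sub_sq ℂ]
    rfl
  have hnorm : ‖1 - p‖ ^ 2 = (1 - p.re) ^ 2 + p.im ^ 2 := by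
    rw [← Complex.normSq_eq_norm_sq, Complex.normSq_apply]
    simp only [Complex.sub_re, Complex.sub_im, Complex.one_re, Complex.one_im]
    ring
  calc (1 - ‖(x : EuclideanSpace ℂ (Fin d))‖ ^ 2) * dist x z ^ 2
      ≤ ‖1 - p‖ ^ 2 - (1 - ‖(x : EuclideanSpace ℂ (Fin d))‖ ^ 2) *
          (1 - ‖(z : EuclideanSpace ℂ (Fin d))‖ ^ 2) := by
        rw [hdist, hnorm]
        nlinarith [sq_nonneg (p.re - ‖(x : EuclideanSpace ℂ (Fin d))‖ ^ 2), sq_nonneg p.im]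
    _ = ‖1 - p‖ ^ 2 * pseudohyperbolicDist x z ^ 2 := by
        rw [← one_sub_pseudohyperbolicDist_sq_mul x z]
        ring
    _ ≤ 2 ^ 2 * pseudohyperbolicDist x z ^ 2 := by gcongr
    _ = 4 * pseudohyperbolicDist x z ^ 2 := by norm_num

theorem eventually_forall_pseudohyperbolicDist_lt (x : UnitBall d) {ε : ℝ} (hε : 0 < ε) :
    ∀ᶠ δ in 𝓝[>] 0, ∀ z, pseudohyperbolicDist x z < δ → dist z x < ε := by
  have hpos := one_sub_norm_sq_pos x
  have hlim : Tendsto (fun δ : ℝ => 4 * δ ^ 2) (𝓝[>] 0) (𝓝 0) :=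
    (Continuous.tendsto' (by fun_prop) _ _ (by norm_num)).mono_left nhdsWithin_le_nhds
  filter_upwards [hlim.eventually_lt_const
    (show 0 < (1 - ‖(x : EuclideanSpace ℂ (Fin d))‖ ^ 2) * ε ^ 2 by positivity)] with δ hδ z hz
  have hρ : pseudohyperbolicDist x z ^ 2 ≤ δ ^ 2 := pow_le_pow_left₀ (norm_nonneg _) hz.le 2
  rw [dist_comm]
  refine lt_of_pow_lt_pow_left₀ 2 hε.le (lt_of_mul_lt_mul_left ?_ hpos.le)
  linarith [one_sub_norm_sq_mul_dist_sq_le x z]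

theorem mem_nhds_iff_pseudohyperbolicDist {ι : Type*} [Finite ι] {x : ι → UnitBall d}
    {U : Set (ι → UnitBall d)} :
    U ∈ 𝓝 x ↔ ∃ ε > 0, ∀ y, (∀ j, pseudohyperbolicDist (x j) (y j) < ε) → y ∈ U := by
  cases nonempty_fintype ι
  constructor
  · intro hU
    obtain ⟨ε, hε, hball⟩ := Metric.mem_nhds_iff.1 hU
    obtain ⟨δ, hδ, hpos⟩ := ((eventually_all.2 fun j =>
      eventually_forall_pseudohyperbolicDist_lt (x j) hε).and self_mem_nhdsWithin).exists
    exact ⟨δ, hpos, fun y hy => hball ((dist_pi_lt_iff hε).2 fun j => hδ j _ (hy j))⟩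
  · rintro ⟨ε, hε, hU⟩
    have hcont (j : ι) : Continuous fun y : ι → UnitBall d => pseudohyperbolicDist (x j) (y j) :=
      (continuous_pseudohyperbolicDist (x j)).comp (continuous_apply j)
    have hnear : ∀ᶠ y in 𝓝 x, ∀ j, pseudohyperbolicDist (x j) (y j) < ε :=
      eventually_all.2 fun j =>
        ((hcont j).tendsto' x 0 (pseudohyperbolicDist_self (x j))).eventually_lt_const hε
    exact mem_of_superset hnear hU

end Pseudohyperbolic

theorem exists_perm_comp_eq_of_map_univ_eq {ι α : Type*} [Fintype ι] {x y : ι → α}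
    (h : Finset.univ.val.map x = Finset.univ.val.map y) : ∃ σ : Equiv.Perm ι, x ∘ σ = y := by
  classical
  have hcard (c : α) : Fintype.card {i // y i = c} = Fintype.card {i // x i = c} := by
    have hcount := congrArg (Multiset.count c) h
    simp only [Multiset.count_map, eq_comm (a := c)] at hcount
    simp only [Fintype.card_subtype, Finset.card_def, Finset.filter_val, hcount]
  exact ⟨Equiv.ofFiberEquiv fun c => Fintype.equivOfCardEq (hcard c),
    funext fun i => Equiv.ofFiberEquiv_map _ i⟩

theorem isOpen_setOf_injective {ι X : Type*} [Finite ι] [TopologicalSpace X] [T2Space X] :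
    IsOpen {x : ι → X | Function.Injective x} := by
  have heq : {x : ι → X | Function.Injective x} = ⋂ i, ⋂ j, {x | i ≠ j → x i ≠ x j} := by
    ext x
    simp only [Set.mem_iInter, Set.mem_ofPred_eq, ne_eq, not_imp_not]
    rfl
  rw [heq]
  refine isOpen_iInter_of_finite fun i => isOpen_iInter_of_finite fun j => ?_
  by_cases hij : i = j
  · simp only [hij, ne_eq, not_true_eq_false, false_imp_iff, Set.ofPred_true, isOpen_univ]
  · simpa only [ne_eq, hij, not_false_eq_true, forall_const] using
      isOpen_ne_fun (continuous_apply i) (continuous_apply j)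

section Symmetrization

open Filter Topology

variable {d n : ℕ}

theorem coe_symmetrize (x : Fin n → UnitBall d) :
    (symmetrize x).1 = (List.ofFn x : Multiset (UnitBall d)) :=
  Fin.univ_val_map x

theorem coe_symmetrize_succ (x : Fin (n + 1) → UnitBall d) :
    (symmetrize x).1 = x 0 ::ₘ (symmetrize (Fin.tail x)).1 := by
  rw [coe_symmetrize, coe_symmetrize, List.ofFn_succ, Multiset.cons_coe]
  rfl

theorem mem_symmetrize {x : Fin n → UnitBall d} {z : UnitBall d} :
    z ∈ (symmetrize x).1 ↔ ∃ i, x i = z := by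
  rw [coe_symmetrize, Multiset.mem_coe, List.mem_ofFn]

theorem nodup_symmetrize {x : Fin n → UnitBall d} :
    (symmetrize x).1.Nodup ↔ Function.Injective x := by
  rw [coe_symmetrize, Multiset.coe_nodup, List.nodup_ofFn]

theorem symmetrize_comp_perm (x : Fin n → UnitBall d) (σ : Equiv.Perm (Fin n)) :
    symmetrize (x ∘ σ) = symmetrize x :=
  Subtype.ext (by
    rw [coe_symmetrize, coe_symmetrize, Multiset.coe_eq_coe]
    exact Equiv.Perm.ofFn_comp_perm σ x)

theorem symmetrize_eq_iff {x y : Fin n → UnitBall d} :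
    symmetrize x = symmetrize y ↔ ∃ σ : Equiv.Perm (Fin n), x ∘ σ = y := by
  constructor
  · exact fun h => exists_perm_comp_eq_of_map_univ_eq (congrArg Subtype.val h)
  · rintro ⟨σ, rfl⟩
    exact (symmetrize_comp_perm x σ).symm

theorem symmetrize_surjective : Function.Surjective (symmetrize (d := d) (n := n)) := by
  rintro ⟨⟨l⟩, hl : l.length = n⟩
  subst hl
  refine ⟨l.get, Subtype.ext ?_⟩
  rw [coe_symmetrize, List.ofFn_get]
  rfl

theorem mem_configSpace_iff {X : SymPolyball d n} : X ∈ configSpace d n ↔ X.1.Nodup := by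
  obtain ⟨x, rfl⟩ := symmetrize_surjective X
  constructor
  · rintro ⟨y, hy, hyx⟩
    exact hyx ▸ nodup_symmetrize.2 hy
  · exact fun h => ⟨x, nodup_symmetrize.1 h, rfl⟩

theorem symDist_symmetrize_lt_iff {x : Fin n → UnitBall d} {Y : SymPolyball d n} {ε : ℝ}
    (hε : 0 < ε) :
    symDist (symmetrize x) Y < ε ↔
      ∃ y, symmetrize y = Y ∧ ∀ j, pseudohyperbolicDist (x j) (y j) < ε := by
  constructor
  · intro h
    obtain ⟨y₀, rfl⟩ := symmetrize_surjective Y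
    obtain ⟨_, ⟨x', y', hx', hy', rfl⟩, hlt⟩ := exists_lt_of_csInf_lt
      (by exact ⟨_, x, y₀, rfl, rfl, rfl⟩) h
    obtain ⟨σ, rfl⟩ := symmetrize_eq_iff.1 hx'
    refine ⟨y' ∘ σ, (symmetrize_comp_perm y' σ).trans hy', fun j => ?_⟩
    exact (le_ciSup (f := fun j => pseudohyperbolicDist (x' j) (y' j))
      (Set.finite_range _).bddAbove (σ j)).trans_lt hlt
  · rintro ⟨y, rfl, hy⟩
    have hbdd : BddBelow {r : ℝ | ∃ x' y' : Fin n → UnitBall d, symmetrize x' = symmetrize x ∧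
        symmetrize y' = symmetrize y ∧ r = ⨆ j, pseudohyperbolicDist (x' j) (y' j)} := by
      refine ⟨0, ?_⟩
      rintro _ ⟨x', y', -, -, rfl⟩
      exact Real.iSup_nonneg fun j => norm_nonneg _
    refine (csInf_le hbdd ⟨x, y, rfl, rfl, rfl⟩).trans_lt ?_
    rcases isEmpty_or_nonempty (Fin n) with hempty | hne
    · rwa [Real.iSup_of_isEmpty]
    · obtain ⟨j, hj⟩ := exists_eq_ciSup_of_finite
        (f := fun j => pseudohyperbolicDist (x j) (y j))
      exact hj ▸ hy j

theorem isOpen_iff_isOpen_preimage_symmetrize {U : Set (SymPolyball d n)} :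
    IsOpen U ↔ IsOpen (symmetrize ⁻¹' U) := by
  change (∀ X ∈ U, ∃ ε > 0, ∀ Y, symDist X Y < ε → Y ∈ U) ↔ _
  simp only [isOpen_iff_mem_nhds, mem_nhds_iff_pseudohyperbolicDist,
    symmetrize_surjective.forall, Set.mem_preimage]
  refine forall₂_congr fun x _ => exists_congr fun ε => and_congr_right fun hε => ?_
  simp only [symDist_symmetrize_lt_iff hε]
  exact ⟨fun h y hy => h y ⟨y, rfl, hy⟩, fun h _ ⟨y, hyz, hy⟩ => hyz ▸ h y hy⟩

theorem isOpenQuotientMap_symmetrize :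
    IsOpenQuotientMap (symmetrize (d := d) (n := n)) where
  surjective := symmetrize_surjective
  continuous := ⟨fun _ hU => isOpen_iff_isOpen_preimage_symmetrize.1 hU⟩
  isOpenMap O hO := by
    have hpre : symmetrize ⁻¹' (symmetrize '' O) =
        ⋃ σ : Equiv.Perm (Fin n), (fun y : Fin n → UnitBall d => y ∘ σ) ⁻¹' O := by
      ext y
      simp only [Set.mem_preimage, Set.mem_image, Set.mem_iUnion, eq_comm (b := symmetrize y),
        symmetrize_eq_iff]
      exact ⟨fun ⟨_, hz, σ, hσ⟩ => ⟨σ, hσ ▸ hz⟩, fun ⟨σ, hσ⟩ => ⟨_, hσ, σ, rfl⟩⟩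
    rw [isOpen_iff_isOpen_preimage_symmetrize, hpre]
    exact isOpen_iUnion fun σ => hO.preimage (by fun_prop)

theorem continuousAt_kernelProj_symmetrize {x : Fin n → UnitBall d}
    (hx : Function.Injective x) :
    ContinuousAt (fun y : Fin n → UnitBall d => kernelProj (symmetrize y).1) x := by
  induction n with
  | zero => exact continuous_of_const (fun y z => by rw [Subsingleton.elim y z]) |>.continuousAt
  | succ n ih =>
    have htail : ContinuousAt (fun y : Fin (n + 1) → UnitBall d =>
        kernelProj (symmetrize (Fin.tail y)).1) x :=
      ContinuousAt.comp (f := Fin.tail) (ih (hx.comp (Fin.succ_injective n)))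
        (continuous_pi fun i => continuous_apply i.succ).continuousAt
    have hvec : ContinuousAt (fun y : Fin (n + 1) → UnitBall d => kernelVec (y 0)) x :=
      continuous_kernelVec.continuousAt.comp (continuous_apply 0).continuousAt
    have hresidual : ContinuousAt (fun y : Fin (n + 1) → UnitBall d =>
        kernelResidual (symmetrize (Fin.tail y)).1 (y 0)) x := by
      simp only [kernelResidual_eq_sub]
      exact hvec.sub (htail.clm_apply hvec)
    have hnotMem : x 0 ∉ (symmetrize (Fin.tail x)).1 := by
      rw [mem_symmetrize]
      exact fun ⟨i, hi⟩ => Fin.succ_ne_zero i (hx hi)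
    simp only [coe_symmetrize_succ, kernelProj_cons]
    have hspan := (continuousAt_starProjection_span_singleton (𝕜 := ℂ)
      (kernelResidual_ne_zero hnotMem)).tendsto.comp hresidual
    exact htail.add hspan

end Symmetrization

/-! ### The homeomorphism -/

section Homeomorphism

open Filter Topology

variable {d n : ℕ}

/-- The map `Φ_{d,n}`. It is defined as the projection onto the span of the kernel functions, which
makes it visibly independent of the ordering of the points; its description by Blaschke rows is
part of the theorem. -/
def Phi (d n : ℕ) (X : configSpace d n) : coinvariantProjDistinct d n :=
  have hX : X.1.1.Nodup := mem_configSpace_iff.1 X.2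
  ⟨⟨kernelProj X.1.1, kernelProj_mem_coinvariantProj hX X.1.2⟩,
    mem_configSpace_iff.2 ((Psi_kernelProj hX X.1.2).symm ▸ hX)⟩

theorem Psi_Phi (X : configSpace d n) : Psi d n (Phi d n X).1 = X.1 :=
  Subtype.ext (Psi_kernelProj (mem_configSpace_iff.1 X.2) X.1.2)

theorem Phi_Psi (P : coinvariantProjDistinct d n) : Phi d n ⟨Psi d n P.1, P.2⟩ = P :=
  Subtype.ext (Subtype.ext (kernelProj_Psi P.1 (mem_configSpace_iff.1 P.2)))

theorem continuous_Phi : Continuous (Phi d n) := by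
  refine Continuous.subtype_mk (Continuous.subtype_mk
    (continuous_iff_continuousAt.2 fun ⟨_, x, hx, hxX⟩ => ?_) _) _
  subst hxX
  have hproj : ContinuousAt (fun X : SymPolyball d n => kernelProj X.1) (symmetrize x) :=
    isOpenQuotientMap_symmetrize.continuousAt_comp_iff.1 (continuousAt_kernelProj_symmetrize hx)
  exact hproj.comp_of_eq continuous_subtype_val.continuousAt rfl

theorem eventually_exists_mem_Psi_dist_lt {P : coinvariantProjDistinct d n} {x : UnitBall d}
    (hx : x ∈ (Psi d n P.1).1) {δ : ℝ} (hδ : 0 < δ) :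
    ∀ᶠ Q in 𝓝 P, ∃ y ∈ (Psi d n Q.1).1, dist y x < δ := by
  obtain ⟨C, -, hC⟩ := exists_prod_dist_sq_le_mul_norm_kernelResidual d n
  have hPx : P.1.1 (kernelVec x) = kernelVec x := by
    rw [← starProjection_coinvariantSubspace P.1]
    exact Submodule.starProjection_eq_self_iff.2 ((mem_Psi_iff P.1).1 hx)
  have hcont : Continuous fun Q : coinvariantProjDistinct d n =>
      C * ‖kernelVec x - Q.1.1 (kernelVec x)‖ := by fun_prop
  have hlim := hcont.tendsto' P 0 (by rw [hPx, sub_self, norm_zero, mul_zero])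
  filter_upwards [hlim.eventually_lt_const (show 0 < (δ ^ 2) ^ n by positivity)] with Q hQ
  by_contra! hfar
  have hresidual := hC x (Psi d n Q.1).1 (Psi d n Q.1).2
  rw [kernelResidual_eq_sub, kernelProj_Psi Q.1 (mem_configSpace_iff.1 Q.2)] at hresidual
  refine (hresidual.trans_lt hQ).not_ge ?_
  calc (δ ^ 2) ^ n = ((Psi d n Q.1).1.map fun _ => δ ^ 2).prod := by
        rw [Multiset.map_const', Multiset.prod_replicate, (Psi d n Q.1).2]
    _ ≤ ((Psi d n Q.1).1.map fun y => dist x y ^ 2).prod :=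
        Multiset.prod_map_le_prod_map₀ _ _ (fun _ _ => by positivity) fun y hy =>
          pow_le_pow_left₀ hδ.le (dist_comm x y ▸ hfar y hy) 2

theorem symmetrize_eq_of_forall_mem {y : Fin n → UnitBall d} {Y : SymPolyball d n}
    (hinj : Function.Injective y) (hmem : ∀ i, y i ∈ Y.1) : symmetrize y = Y := by
  refine Subtype.ext (Multiset.eq_of_le_of_card_le
    ((Multiset.le_iff_subset (nodup_symmetrize.2 hinj)).2 fun z hz => ?_) ?_)
  · obtain ⟨i, rfl⟩ := mem_symmetrize.1 hz
    exact hmem i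
  · exact (Y.2.trans (symmetrize y).2.symm).le

theorem continuous_Psi_distinct :
    Continuous fun P : coinvariantProjDistinct d n => Psi d n P.1 := by
  refine continuous_iff_continuousAt.2 fun P => ?_
  obtain ⟨x, hx, hxP⟩ := P.2
  intro U hU
  change U ∈ 𝓝 (Psi d n P.1) at hU
  rw [← hxP, ← isOpenQuotientMap_symmetrize.map_nhds_eq, mem_map] at hU
  obtain ⟨δ, hδ, hball⟩ :=
    Metric.mem_nhds_iff.1 (inter_mem hU (isOpen_setOf_injective.mem_nhds hx))
  have hmem (i : Fin n) : x i ∈ (Psi d n P.1).1 := hxP ▸ mem_symmetrize.2 ⟨i, rfl⟩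
  rw [mem_map]
  filter_upwards [eventually_all.2 fun i => eventually_exists_mem_Psi_dist_lt (hmem i) hδ]
    with Q hQ
  choose y hyQ hyx using hQ
  obtain ⟨hyU, hyinj⟩ := hball (Metric.mem_ball.2 ((dist_pi_lt_iff hδ).2 hyx))
  change Psi d n Q.1 ∈ U
  exact symmetrize_eq_of_forall_mem hyinj hyQ ▸ hyU

/-- The restriction of `Ψ_{d,n}` to the preimage of the configuration space, with inverse
`Φ_{d,n}`. -/
def psiHomeomorph (d n : ℕ) : coinvariantProjDistinct d n ≃ₜ configSpace d n where
  toFun P := ⟨Psi d n P.1, P.2⟩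
  invFun := Phi d n
  left_inv := Phi_Psi
  right_inv X := Subtype.ext (Psi_Phi X)
  continuous_toFun := continuous_Psi_distinct.subtype_mk _
  continuous_invFun := continuous_Phi

theorem span_range_kerFun (x : Fin n → UnitBall d) :
    Submodule.span ℂ (Set.range fun i => RKHS.kerFun (DruryArveson d) (x i) 1) =
      kernelSpan (symmetrize x).1 := by
  simp only [kernelSpan, kerFun_one, mem_symmetrize, ← Set.mem_range, Set.ofPred_mem_eq]
  rw [← Set.range_comp]
  rfl

end Homeomorphism

end

theorem theorem4p3 (d n : ℕ) (hd : 0 < d) (hn : 0 < n) :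
    -- `Ψ` is well defined on all of `ℙ_{d,n}`
    (∀ P : coinvariantProj d n, IsJointSpectrumWithMult (compressedShift P.1) (Psi d n P)) ∧
    ∃ Φ : configSpace d n → coinvariantProjDistinct d n,
      -- `Φ[X] = I - M_{b_X} M_{b_X}^*` for every ordering `x` of `X` and every choice of `b_X`
      (∀ (X : configSpace d n) (x : Fin n → UnitBall d), symmetrize x = X.1 →
        (∃ b : UnitBall d → EuclideanSpace ℂ (Fin ((n - 1) * (d - 1) + d)),
          IsBlaschkeRow (List.ofFn x) ((n - 1) * (d - 1) + d) b) ∧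
        ∀ (N : ℕ) (b : UnitBall d → EuclideanSpace ℂ (Fin N)), IsBlaschkeRow (List.ofFn x) N b →
          ∃ M : PiLp 2 (fun _ : Fin N => DruryArveson d) →L[ℂ] DruryArveson d,
            IsRowMultiplicationOp b M ∧
            M ∘L ContinuousLinearMap.adjoint M ∘L M = M ∧
            (M : PiLp 2 (fun _ : Fin N => DruryArveson d) →ₗ[ℂ] DruryArveson d).range =
              (Submodule.span ℂ (Set.range fun i => RKHS.kerFun (DruryArveson d) (x i) 1))ᗮ ∧
            ((Φ X).1.1 : DruryArveson d →L[ℂ] DruryArveson d) =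
              ContinuousLinearMap.id ℂ (DruryArveson d) - M ∘L ContinuousLinearMap.adjoint M) ∧
      Continuous Φ ∧
      (∀ X : configSpace d n, Psi d n (Φ X).1 = X.1) ∧
      (∀ P : coinvariantProjDistinct d n, Φ ⟨Psi d n P.1, P.2⟩ = P) ∧
      ∃ e : coinvariantProjDistinct d n ≃ₜ configSpace d n,
        (∀ P, (e P).1 = Psi d n P.1) ∧ ∀ X, e.symm X = Φ X := by
  refine ⟨isJointSpectrumWithMult_Psi, Phi d n, fun X x hxX => ⟨?_, fun N b hb => ?_⟩,
    continuous_Phi, Psi_Phi, Phi_Psi, psiHomeomorph d n, fun _ => rfl, fun _ => rfl⟩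
  · have hnodup : (List.ofFn x).Nodup := by
      rw [List.nodup_ofFn, ← nodup_symmetrize, hxX]
      exact mem_configSpace_iff.1 X.2
    have hrow := exists_isBlaschkeRow hd hnodup
      (List.ne_nil_of_length_pos (by rwa [List.length_ofFn]))
    rwa [List.length_ofFn] at hrow
  · obtain ⟨M, hM, hproj⟩ := hb.exists_isRowMultiplicationOp
    rw [← coe_symmetrize] at hproj
    refine ⟨M, hM, comp_adjoint_comp_self_of_comp_adjoint hproj, ?_, ?_⟩
    · rw [span_range_kerFun, range_eq_of_comp_adjoint hproj]
    · have hcompl : (kernelSpan X.1.1)ᗮ.starProjection = .id ℂ _ - kernelProj X.1.1 :=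
        Submodule.starProjection_orthogonal _
      rw [hproj, hxX, hcompl, sub_sub_cancel]
      rfl
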